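/- Let $k$ be a field and let $(H,\Delta)$ be a Hopf $k$-algebra with antipode $S$ that has invariant functionals, i.e. there are non-zero linear functionals $\varphi,\psi:H\to k$ with $(\mathrm{id}\otimes\varphi)\Delta(h)=\varphi(h)1$ and $(\psi\otimes\mathrm{id})\Delta(h)=\psi(h)1$ for all $h\in H$. Let $\hat H=\{\varphi(h\,-)\mid h\in H\}\subseteq H^*$, an algebra under the convolution product $(\omega*\chi)(h)=(\omega\otimes\chi)\Delta(h)$. Let $A$ be an associative, not necessarily unital $k$-algebra with a right $H$-comodule algebra structure $\alpha:A\to A\otimes H$, $a\mapsto a_{(0)}\otimes a_{(1)}$. Assume that $(A,\alpha)$ has $H$-coinvariant local units: for every finite subset $\{a_1,\dots,a_n\}\subseteq A$ there is $e\in A$ with $\alpha(e)=e\otimes 1$ and $ea_i=a_i=a_ie$ for all $i$. Let $A\#\hat H$ be the vector space $A\otimes\hat H$ with the product $(a\#\omega)(b\#\chi)=ab_{(0)}\#\omega(b_{(1)}-)*\chi$. It is a left $H$-module algebra by $h\cdot(a\#\omega)=a\#\omega(-h)$. Let $(A\#\hat H)\#H$ be the vector space $(A\#\hat H)\otimes H$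 with the product $(x\#h)(y\#l)=x(h_{(1)}\cdot y)\#h_{(2)}l$, and endow it with the $S^2$-twisted dual coaction $$\widehat{\widehat{\alpha}}_{S^2}:\ x\#h\mapsto (x\#h_{(1)})\otimes S^2(h_{(2)}),\qquad x\in A\#\hat H,\ h\in H,$$ which makes it a right $H$-comodule algebra. Then $(A,\alpha)$ and $((A\#\hat H)\#H,\widehat{\widehat{\alpha}}_{S^2})$ are $H$-equivariantly Morita equivalent. That is, there are right $H$-comodules $A_{ij}$, $i,j\in\{1,2\}$, with $H$-colinear bilinear multiplication maps $A_{ij}\times A_{jl}\to A_{il}$ satisfying $(xy)z=x(yz)$ whenever this makes sense, such that the four induced maps $A_{ij}\otimes_{A_{jj}}A_{ji}\to A_{ii}$ are bijective, and such that $A_{11}\cong(A,\alpha)$ and $A_{22}\cong((A\#\hat H)\#H,\widehat{\widehat{\alpha}}_{S^2})$ as $H$-comodule algebras. -/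

import Mathlib

open scoped TensorProduct

noncomputable section

namespace EquivMorita

universe u v w w'

section Dual
variable {k : Type u} {H : Type v} [Field k] [Ring H] [HopfAlgebra k H]

/-- The convolution product `(ω * χ)(h) = (ω ⊗ χ) Δ(h)` of two functionals. -/
def convol : Module.Dual k H →ₗ[k] Module.Dual k H →ₗ[k] Module.Dual k H :=
  LinearMap.mk₂ k
    (fun ω χ => (TensorProduct.lid k k).toLinearMap ∘ₗ TensorProduct.map ω χ ∘ₗ
      Coalgebra.comul)
    (by intros; simp [TensorProduct.map_add_left, LinearMap.comp_add, LinearMap.add_comp])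
    (by intros; simp [TensorProduct.map_smul_left, LinearMap.comp_smul, LinearMap.smul_comp])
    (by intros; simp [TensorProduct.map_add_right, LinearMap.comp_add, LinearMap.add_comp])
    (by intros; simp [TensorProduct.map_smul_right, LinearMap.comp_smul, LinearMap.smul_comp])

theorem convol_assoc (ω χ θ : Module.Dual k H) :
    convol (convol ω χ) θ = convol ω (convol χ θ) := by
  have h := congrArg WithConv.ofConv
    (mul_assoc (WithConv.toConv ω) (WithConv.toConv χ) (WithConv.toConv θ))
  exact h

/-- `shift ω h` is the functional `ω(h -)`. -/
def shift : Module.Dual k H →ₗ[k] H →ₗ[k] Module.Dual k H :=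
  LinearMap.mk₂ k (fun ω h => ω ∘ₗ LinearMap.mulLeft k h)
    (by intros; ext; simp) (by intros; ext; simp)
    (by intros; ext; simp [add_mul]) (by intros; ext; simp)

/-- `rshift h ω` is the functional `ω(- h)`. -/
def rshift : H →ₗ[k] Module.Dual k H →ₗ[k] Module.Dual k H :=
  LinearMap.mk₂ k (fun h ω => ω ∘ₗ LinearMap.mulRight k h)
    (by intros; ext; simp [mul_add]) (by intros; ext; simp)
    (by intros; ext; simp) (by intros; ext; simp)

@[simp] theorem shift_apply (ω : Module.Dual k H) (h x : H) : shift ω h x = ω (h * x) := rfl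
@[simp] theorem rshift_apply (ω : Module.Dual k H) (h x : H) : rshift h ω x = ω (x * h) := rfl
theorem convol_apply (ω χ : Module.Dual k H) (x : H) :
    convol ω χ x = TensorProduct.lid k k (TensorProduct.map ω χ (Coalgebra.comul x)) := rfl

theorem shift_convol (ω χ : Module.Dual k H) (h : H) :
    shift (convol ω χ) h =
      TensorProduct.lift (convol.compl₁₂ (shift ω) (shift χ)) (Coalgebra.comul h) := by
  ext x
  rw [shift_apply, convol_apply, Bialgebra.comul_mul]
  induction Coalgebra.comul (R := k) h with
  | zero => simp
  | add a b ha hb => simp [add_mul, ha, hb]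
  | tmul a b =>
    simp only [TensorProduct.lift.tmul, LinearMap.compl₁₂_apply, convol_apply]
    induction Coalgebra.comul (R := k) x with
    | zero => simp
    | add a b ha hb => simp only [mul_add, map_add, ha, hb]
    | tmul c d => simp

theorem rshift_convol (ω χ : Module.Dual k H) (h : H) :
    rshift h (convol ω χ) =
      TensorProduct.lift (convol.compl₁₂ (rshift.flip ω) (rshift.flip χ))
        (Coalgebra.comul h) := by
  ext x
  rw [rshift_apply, convol_apply, Bialgebra.comul_mul]
  induction Coalgebra.comul (R := k) h with
  | zero => simp
  | add a b ha hb => simp [mul_add, ha, hb]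
  | tmul a b =>
    simp only [TensorProduct.lift.tmul, LinearMap.compl₁₂_apply, convol_apply]
    induction Coalgebra.comul (R := k) x with
    | zero => simp
    | add a b ha hb => simp only [add_mul, map_add, ha, hb]
    | tmul c d => simp

variable (k H) in
/-- A pair of non-zero functionals `φ`, `ψ` on a Hopf algebra, where `φ` is left invariant,
`(id ⊗ φ) Δ(h) = φ(h) 1`, and `ψ` is right invariant, `(ψ ⊗ id) Δ(h) = ψ(h) 1`. -/
structure InvariantFunctionals where
  φ : Module.Dual k H
  ψ : Module.Dual k H
  φ_ne_zero : φ ≠ 0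
  ψ_ne_zero : ψ ≠ 0
  left_invariant : ∀ h : H,
    TensorProduct.rid k H (LinearMap.lTensor H φ (Coalgebra.comul h)) = φ h • (1 : H)
  right_invariant : ∀ h : H,
    TensorProduct.lid k H (LinearMap.rTensor H ψ (Coalgebra.comul h)) = ψ h • (1 : H)

/-- The dual `Ĥ = {φ(h -) | h ∈ H}`, a subspace of the linear dual of `H`. -/
def dualHat (F : InvariantFunctionals k H) : Submodule k (Module.Dual k H) :=
  LinearMap.range (shift F.φ)

theorem convol_shift_phi (F : InvariantFunctionals k H) (ω : Module.Dual k H) (h : H) :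
    convol ω (shift F.φ h) = shift F.φ (TensorProduct.lid k H
      (TensorProduct.map (ω ∘ₗ HopfAlgebra.antipode k) LinearMap.id (Coalgebra.comul h))) := by
  ext x
  let Ω : H ⊗[k] H →ₗ[k] k := (TensorProduct.lid k k).toLinearMap ∘ₗ TensorProduct.map ω F.φ
  let T : H ⊗[k] (H ⊗[k] H) →ₗ[k] k :=
    Ω ∘ₗ LinearMap.mulRight k (Coalgebra.comul x) ∘ₗ TensorProduct.lift
      (LinearMap.mul k (H ⊗[k] H) ∘ₗ (TensorProduct.mk k H H).flip 1 ∘ₗ HopfAlgebra.antipode k)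
  have hT : ∀ (a : H) (t : H ⊗[k] H), T (a ⊗ₜ t) =
      Ω ((HopfAlgebra.antipode k a ⊗ₜ 1) * t * Coalgebra.comul x) := fun a t => rfl
  have hΩ : ∀ s y : H, Ω ((s ⊗ₜ 1) * Coalgebra.comul y) = ω s * F.φ y := by
    intro s y
    have h1 : ∀ t : H ⊗[k] H, Ω ((s ⊗ₜ 1) * t) =
        ω (s * TensorProduct.rid k H (LinearMap.lTensor H F.φ t)) := by
      intro t
      induction t with
      | zero => simp
      | add a b ha hb => simp only [mul_add, map_add, ha, hb]
      | tmul a b => simp [Ω, mul_comm]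
    rw [h1, F.left_invariant]
    simp [mul_comm]
  have key := congrArg T (Coalgebra.coassoc_apply (R := k) h)
  have hl : ∀ t : H ⊗[k] H, T (TensorProduct.assoc k H H H
      (LinearMap.rTensor H Coalgebra.comul t)) =
      Ω (((1 : H) ⊗ₜ TensorProduct.lid k H (LinearMap.rTensor H Coalgebra.counit t)) *
        Coalgebra.comul x) := by
    intro t
    induction t with
    | zero => simp
    | add a b ha hb => simp only [TensorProduct.tmul_add, add_mul, map_add, ha, hb]
    | tmul a b =>
      have h2 : ∀ t : H ⊗[k] H, T (TensorProduct.assoc k H H H (t ⊗ₜ b)) =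
          Ω (((LinearMap.mul' k H (LinearMap.rTensor H (HopfAlgebra.antipode k) t)) ⊗ₜ b) *
            Coalgebra.comul x) := by
        intro t
        induction t with
        | zero => simp
        | add a b ha hb => simp only [TensorProduct.add_tmul, add_mul, map_add, ha, hb]
        | tmul c d => simp [hT]
      rw [LinearMap.rTensor_tmul, h2, HopfAlgebra.mul_antipode_rTensor_comul_apply]
      simp [Algebra.algebraMap_eq_smul_one, TensorProduct.smul_tmul]
  have hr : ∀ t : H ⊗[k] H, T (LinearMap.lTensor H Coalgebra.comul t) =
      F.φ (TensorProduct.lid k H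
        (TensorProduct.map (ω ∘ₗ HopfAlgebra.antipode k) LinearMap.id t) * x) := by
    intro t
    induction t with
    | zero => simp
    | add a b ha hb => simp only [add_mul, map_add, ha, hb]
    | tmul a b =>
      rw [LinearMap.lTensor_tmul, hT, mul_assoc, ← Bialgebra.comul_mul, hΩ]
      simp
  rw [hl, hr] at key
  rw [shift_apply, ← key, Coalgebra.rTensor_counit_comul, TensorProduct.lid_tmul, one_smul,
    convol_apply]
  induction Coalgebra.comul (R := k) x with
  | zero => simp
  | add a b ha hb => simp only [mul_add, map_add, ha, hb]
  | tmul c d => simp [Ω]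


theorem convol_rshift_psi (F : InvariantFunctionals k H) (ω : Module.Dual k H) (c : H) :
    convol (rshift c F.ψ) ω = rshift (TensorProduct.rid k H
      (TensorProduct.map LinearMap.id (ω ∘ₗ HopfAlgebra.antipode k) (Coalgebra.comul c))) F.ψ := by
  ext x
  let Ω : H ⊗[k] H →ₗ[k] k := (TensorProduct.lid k k).toLinearMap ∘ₗ TensorProduct.map F.ψ ω
  let T : (H ⊗[k] H) ⊗[k] H →ₗ[k] k :=
    Ω ∘ₗ LinearMap.mulLeft k (Coalgebra.comul x) ∘ₗ TensorProduct.lift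
      ((LinearMap.mul k (H ⊗[k] H)).compl₂ ((TensorProduct.mk k H H 1) ∘ₗ HopfAlgebra.antipode k))
  have hT : ∀ (a : H) (t : H ⊗[k] H), T (t ⊗ₜ a) =
      Ω (Coalgebra.comul x * (t * (1 ⊗ₜ HopfAlgebra.antipode k a))) := fun a t => rfl
  have hΩ : ∀ s y : H, Ω (Coalgebra.comul y * (1 ⊗ₜ s)) = ω s * F.ψ y := by
    intro s y
    have h1 : ∀ t : H ⊗[k] H, Ω (t * (1 ⊗ₜ s)) =
        ω (TensorProduct.lid k H (LinearMap.rTensor H F.ψ t) * s) := by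
      intro t
      induction t with
      | zero => simp
      | add a b ha hb => simp only [add_mul, map_add, ha, hb]
      | tmul a b => simp [Ω]
    rw [h1, F.right_invariant]
    simp [mul_comm]
  have key := congrArg T (Coalgebra.coassoc_symm_apply (R := k) c)
  have hl : ∀ t : H ⊗[k] H, T ((TensorProduct.assoc k H H H).symm
      (LinearMap.lTensor H Coalgebra.comul t)) =
      Ω (Coalgebra.comul x *
        (TensorProduct.rid k H (LinearMap.lTensor H Coalgebra.counit t) ⊗ₜ (1 : H))) := by
    intro t
    induction t with
    | zero => simp
    | add a b ha hb => simp only [TensorProduct.add_tmul, mul_add, map_add, ha, hb]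
    | tmul a b =>
      have h2 : ∀ t : H ⊗[k] H, T ((TensorProduct.assoc k H H H).symm (a ⊗ₜ t)) =
          Ω (Coalgebra.comul x *
            (a ⊗ₜ (LinearMap.mul' k H (LinearMap.lTensor H (HopfAlgebra.antipode k) t)))) := by
        intro t
        induction t with
        | zero => simp
        | add a b ha hb => simp only [TensorProduct.tmul_add, mul_add, map_add, ha, hb]
        | tmul c d => simp [hT]
      rw [LinearMap.lTensor_tmul, h2, HopfAlgebra.mul_antipode_lTensor_comul_apply]
      simp [Algebra.algebraMap_eq_smul_one, TensorProduct.smul_tmul]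
  have hr : ∀ t : H ⊗[k] H, T (LinearMap.rTensor H Coalgebra.comul t) =
      F.ψ (x * TensorProduct.rid k H
        (TensorProduct.map LinearMap.id (ω ∘ₗ HopfAlgebra.antipode k) t)) := by
    intro t
    induction t with
    | zero => simp
    | add a b ha hb => simp only [mul_add, map_add, ha, hb]
    | tmul a b =>
      rw [LinearMap.rTensor_tmul, hT, ← mul_assoc, ← Bialgebra.comul_mul, hΩ]
      simp
  rw [hl, hr] at key
  rw [rshift_apply, ← key, Coalgebra.lTensor_counit_comul, TensorProduct.rid_tmul, one_smul,
    convol_apply]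
  induction Coalgebra.comul (R := k) x with
  | zero => simp
  | add a b ha hb => simp only [add_mul, map_add, ha, hb]
  | tmul c d => simp [Ω]

theorem phi_psi_aux (F : InvariantFunctionals k H)
    (a c : H) :
    shift F.φ (TensorProduct.lid k H (TensorProduct.map
        (rshift c F.ψ ∘ₗ HopfAlgebra.antipode k) LinearMap.id (Coalgebra.comul a))) =
      rshift (TensorProduct.rid k H (TensorProduct.map LinearMap.id
        (shift F.φ a ∘ₗ HopfAlgebra.antipode k) (Coalgebra.comul c))) F.ψ := by
  rw [← convol_shift_phi, ← convol_rshift_psi]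

theorem exists_map_eq_one {V : Type*} [AddCommGroup V] [Module k V] {f : V →ₗ[k] k}
    (hf : f ≠ 0) : ∃ y, f y = 1 := by
  obtain ⟨y, hy⟩ : ∃ y, f y ≠ 0 := by
    by_contra! h
    exact hf (LinearMap.ext h)
  exact ⟨(f y)⁻¹ • y, by simp [hy]⟩

theorem exists_rshift_eq_shift (F : InvariantFunctionals k H) (a : H) : ∃ c : H, rshift c F.ψ = shift F.φ a := by
  obtain ⟨y, hy⟩ := exists_map_eq_one F.ψ_ne_zero
  let S : H →ₗ[k] H := HopfAlgebra.antipode k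
  let P : Submodule k H := (LinearMap.range (rshift.flip F.ψ)).comap (shift F.φ)
  -- `T (p ⊗ (q₁ ⊗ q₂)) = ψ (S q₁ * S (S p) * y) q₂`
  let T : H ⊗[k] (H ⊗[k] H) →ₗ[k] H := TensorProduct.lift
    (LinearMap.mk₂ k (fun p t => TensorProduct.lid k H (TensorProduct.map
      (rshift (S (S p) * y) F.ψ ∘ₗ S) LinearMap.id t))
      (by intros; simp [add_mul, TensorProduct.map_add_left, LinearMap.add_comp])
      (by intros; simp [TensorProduct.map_smul_left, LinearMap.smul_comp])
      (by intros; simp) (by intros; simp))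
  have hT : ∀ p t, T (p ⊗ₜ t) = TensorProduct.lid k H (TensorProduct.map
      (rshift (S (S p) * y) F.ψ ∘ₗ S) LinearMap.id t) := fun p t => rfl
  have hr : ∀ t : H ⊗[k] H, T (LinearMap.lTensor H Coalgebra.comul t) ∈ P := by
    intro t
    induction t with
    | zero => simp
    | add a b ha hb => simpa only [map_add] using P.add_mem ha hb
    | tmul a b =>
      rw [LinearMap.lTensor_tmul, hT]
      exact ⟨_, (phi_psi_aux F b (S (S a) * y)).symm⟩
  have hl : ∀ t : H ⊗[k] H, T (TensorProduct.assoc k H H H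
      (LinearMap.rTensor H Coalgebra.comul t)) =
      TensorProduct.lid k H (LinearMap.rTensor H Coalgebra.counit t) := by
    intro t
    induction t with
    | zero => simp
    | add a b ha hb => simp only [map_add, ha, hb]
    | tmul a b =>
      have h2 : ∀ t : H ⊗[k] H, T (TensorProduct.assoc k H H H (t ⊗ₜ b)) =
          F.ψ (S (LinearMap.mul' k H (LinearMap.rTensor H S t)) * y) • b := by
        intro t
        induction t with
        | zero => simp
        | add a b ha hb => simp only [TensorProduct.add_tmul, add_mul, map_add, ha, hb, add_smul]
        | tmul c d => simp [hT, S, HopfAlgebra.antipode_mul_antidistrib, mul_assoc]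
      rw [LinearMap.rTensor_tmul, h2]
      simp only [S]
      rw [HopfAlgebra.mul_antipode_rTensor_comul_apply]
      simp [Algebra.algebraMap_eq_smul_one, hy]
  have key := hr (Coalgebra.comul a)
  rw [← Coalgebra.coassoc_apply, hl, Coalgebra.rTensor_counit_comul, TensorProduct.lid_tmul,
    one_smul] at key
  exact key

theorem rshift_mem_dualHat (F : InvariantFunctionals k H) (c : H) : rshift c F.ψ ∈ dualHat F := by
  obtain ⟨y, hy⟩ := exists_map_eq_one F.φ_ne_zero
  let S : H →ₗ[k] H := HopfAlgebra.antipode k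
  let P : Submodule k H := (dualHat F).comap (rshift.flip F.ψ)
  -- `T ((q₁ ⊗ q₂) ⊗ p) = φ (y * S (S p) * S q₂) q₁`
  let T : (H ⊗[k] H) ⊗[k] H →ₗ[k] H := TensorProduct.lift
    (LinearMap.mk₂ k (fun t p => TensorProduct.rid k H (TensorProduct.map LinearMap.id
      (shift F.φ (y * S (S p)) ∘ₗ S) t))
      (by intros; simp) (by intros; simp)
      (by intros; simp [mul_add, TensorProduct.map_add_right, LinearMap.add_comp])
      (by intros; simp [TensorProduct.map_smul_right, LinearMap.smul_comp]))
  have hT : ∀ p t, T (t ⊗ₜ p) = TensorProduct.rid k H (TensorProduct.map LinearMap.id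
      (shift F.φ (y * S (S p)) ∘ₗ S) t) := fun p t => rfl
  have hr : ∀ t : H ⊗[k] H, T (LinearMap.rTensor H Coalgebra.comul t) ∈ P := by
    intro t
    induction t with
    | zero => simp
    | add a b ha hb => simpa only [map_add] using P.add_mem ha hb
    | tmul a b =>
      rw [LinearMap.rTensor_tmul, hT]
      exact ⟨_, phi_psi_aux F (y * S (S b)) a⟩
  have hl : ∀ t : H ⊗[k] H, T ((TensorProduct.assoc k H H H).symm
      (LinearMap.lTensor H Coalgebra.comul t)) =
      TensorProduct.rid k H (LinearMap.lTensor H Coalgebra.counit t) := by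
    intro t
    induction t with
    | zero => simp
    | add a b ha hb => simp only [map_add, ha, hb]
    | tmul a b =>
      have h2 : ∀ t : H ⊗[k] H, T ((TensorProduct.assoc k H H H).symm (a ⊗ₜ t)) =
          F.φ (y * S (LinearMap.mul' k H (LinearMap.lTensor H S t))) • a := by
        intro t
        induction t with
        | zero => simp
        | add a b ha hb => simp only [TensorProduct.tmul_add, mul_add, map_add, ha, hb, add_smul]
        | tmul c d => simp [hT, S, HopfAlgebra.antipode_mul_antidistrib, mul_assoc]
      rw [LinearMap.lTensor_tmul, h2]
      simp only [S]
      rw [HopfAlgebra.mul_antipode_lTensor_comul_apply]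
      simp [Algebra.algebraMap_eq_smul_one, hy]
  have key := hr (Coalgebra.comul c)
  rw [← Coalgebra.coassoc_symm_apply, hl, Coalgebra.lTensor_counit_comul, TensorProduct.rid_tmul,
    one_smul] at key
  exact key

theorem convol_mem (F : InvariantFunctionals k H) (ω : Module.Dual k H)
    {χ : Module.Dual k H} (hχ : χ ∈ dualHat F) : convol ω χ ∈ dualHat F := by
  obtain ⟨h, rfl⟩ := hχ
  exact ⟨_, (convol_shift_phi F ω h).symm⟩

theorem shift_mem (F : InvariantFunctionals k H) {ω : Module.Dual k H}
    (hω : ω ∈ dualHat F) (h : H) : shift ω h ∈ dualHat F := by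
  obtain ⟨a, rfl⟩ := hω
  exact ⟨a * h, by ext x; simp [mul_assoc]⟩

theorem rshift_mem (F : InvariantFunctionals k H)
    {ω : Module.Dual k H} (hω : ω ∈ dualHat F) (h : H) : rshift h ω ∈ dualHat F := by
  obtain ⟨a, rfl⟩ := hω
  obtain ⟨c, hc⟩ := exists_rshift_eq_shift F a
  rw [← hc]
  convert rshift_mem_dualHat F (h * c) using 1
  ext x
  simp [mul_assoc]

variable (F : InvariantFunctionals k H)

/-- `Ĥ` with the convolution product. -/
instance : NonUnitalRing (dualHat F) :=
  { (inferInstance : AddCommGroup (dualHat F)) with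
    mul := fun ω χ => ⟨convol ω.1 χ.1, convol_mem F ω.1 χ.2⟩
    left_distrib := fun ω χ θ => Subtype.ext (map_add (convol ω.1) χ.1 θ.1)
    right_distrib := fun ω χ θ => Subtype.ext (LinearMap.map_add₂ convol ω.1 χ.1 θ.1)
    zero_mul := fun ω => Subtype.ext (LinearMap.map_zero₂ convol ω.1)
    mul_zero := fun ω => Subtype.ext (map_zero (convol ω.1))
    mul_assoc := fun ω χ θ => Subtype.ext (convol_assoc ω.1 χ.1 θ.1) }

theorem dualHat_coe_mul (ω χ : dualHat F) :
    ((ω * χ : dualHat F) : Module.Dual k H) = convol ω.1 χ.1 := rfl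

instance : IsScalarTower k (dualHat F) (dualHat F) :=
  ⟨fun c ω χ => Subtype.ext (LinearMap.map_smul₂ convol c ω.1 χ.1)⟩

instance : SMulCommClass k (dualHat F) (dualHat F) :=
  ⟨fun c ω χ => Subtype.ext ((map_smul (convol ω.1) c χ.1).symm)⟩

/-- `hatShift F ω h = ω(h -)` for `ω` in `Ĥ`. -/
def hatShift : dualHat F →ₗ[k] H →ₗ[k] dualHat F :=
  LinearMap.mk₂ k (fun ω h => ⟨shift ω.1 h, shift_mem F ω.2 h⟩)
    (by intros; ext; simp) (by intros; ext; simp)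
    (by intros; ext; simp) (by intros; ext; simp)

/-- `hatRshift F h ω = ω(- h)` for `ω` in `Ĥ`. -/
def hatRshift : H →ₗ[k] dualHat F →ₗ[k] dualHat F :=
  LinearMap.mk₂ k (fun h ω => ⟨rshift h ω.1, rshift_mem F ω.2 h⟩)
    (by intros; ext; simp) (by intros; ext; simp)
    (by intros; ext; simp) (by intros; ext; simp)

theorem hatShift_hatShift (ω : dualHat F) (h l : H) :
    hatShift F (hatShift F ω h) l = hatShift F ω (h * l) := by
  ext x; simp [hatShift, mul_assoc]

theorem hatRshift_hatShift (ω : dualHat F) (h l : H) :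
    hatRshift F l (hatShift F ω h) = hatShift F (hatRshift F l ω) h := by
  ext x; simp [hatShift, hatRshift, mul_assoc]

theorem hatShift_mul (ω χ : dualHat F) (h : H) :
    hatShift F (ω * χ) h = TensorProduct.lift
      ((LinearMap.mul k (dualHat F)).compl₁₂ (hatShift F ω) (hatShift F χ))
        (Coalgebra.comul h) := by
  refine Subtype.ext ((shift_convol ω.1 χ.1 h).trans ?_)
  induction Coalgebra.comul (R := k) h with
  | zero => simp
  | add a b ha hb => simp only [map_add, ha, hb, Submodule.coe_add]
  | tmul a b => rfl

theorem hatRshift_mul (ω χ : dualHat F) (h : H) :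
    hatRshift F h (ω * χ) = TensorProduct.lift
      ((LinearMap.mul k (dualHat F)).compl₁₂ ((hatRshift F).flip ω) ((hatRshift F).flip χ))
        (Coalgebra.comul h) := by
  refine Subtype.ext ((rshift_convol ω.1 χ.1 h).trans ?_)
  induction Coalgebra.comul (R := k) h with
  | zero => simp
  | add a b ha hb => simp only [map_add, ha, hb, Submodule.coe_add]
  | tmul a b => rfl

end Dual

section Coactions
variable (k : Type u) (H : Type v) [Field k] [Ring H] [HopfAlgebra k H]

/-- A right `H`-comodule structure on the vector space `V`. -/
structure RightComodule (V : Type w) [AddCommGroup V] [Module k V] where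
  coact : V →ₗ[k] V ⊗[k] H
  coassoc : ∀ v : V, TensorProduct.assoc k V H H (LinearMap.rTensor H coact (coact v)) =
    LinearMap.lTensor V Coalgebra.comul (coact v)
  counit_coact : ∀ v : V,
    TensorProduct.rid k V (LinearMap.lTensor V Coalgebra.counit (coact v)) = v

/-- A coaction of `H` on the (not necessarily unital) algebra `A`, that is, the structure of a
right `H`-comodule algebra on `A`. -/
structure Coaction (A : Type w) [NonUnitalRing A] [Module k A] [IsScalarTower k A A]
    [SMulCommClass k A A] extends RightComodule k H A where
  coact_mul : ∀ a b : A, coact (a * b) = coact a * coact b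

/-- A left `H`-module algebra structure on the (not necessarily unital) algebra `B`. -/
structure HopfAction (B : Type w) [NonUnitalRing B] [Module k B] [IsScalarTower k B B]
    [SMulCommClass k B B] where
  act : H →ₗ[k] B →ₗ[k] B
  one_act : ∀ b : B, act 1 b = b
  mul_act : ∀ (h l : H) (b : B), act (h * l) b = act h (act l b)
  /-- `h · (b c) = (h₍₁₎ · b) (h₍₂₎ · c)` -/
  act_mul : ∀ (h : H) (b c : B), act h (b * c) =
    TensorProduct.lift ((LinearMap.mul k B).compl₁₂ (act.flip b) (act.flip c))
      (Coalgebra.comul h)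

end Coactions

namespace Coaction
variable {k : Type u} {H : Type v} [Field k] [Ring H] [HopfAlgebra k H]
variable {A : Type w} [NonUnitalRing A] [Module k A] [IsScalarTower k A A] [SMulCommClass k A A]

/-- `a` is coinvariant if `α(a) = a ⊗ 1`. -/
def IsCoinvariant (α : Coaction k H A) (a : A) : Prop := α.coact a = a ⊗ₜ[k] (1 : H)

/-- Every finite subset of `A` has a two-sided unit that is coinvariant. -/
def HasCoinvariantLocalUnits (α : Coaction k H A) : Prop :=
  ∀ s : Finset A, ∃ e : A, α.IsCoinvariant e ∧ ∀ a ∈ s, e * a = a ∧ a * e = a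

/-- The coaction `(id ⊗ σ) α`, for a homomorphism of bialgebras `σ`. -/
def twist (α : Coaction k H A) (σ : H →ₐc[k] H) : Coaction k H A where
  coact := LinearMap.lTensor A (σ : H →ₗ[k] H) ∘ₗ α.coact
  coassoc v := by
    have h := congrArg (TensorProduct.map LinearMap.id (TensorProduct.map (σ : H →ₗ[k] H)
      (σ : H →ₗ[k] H))) (α.coassoc v)
    have h1 : ∀ t : A ⊗[k] H, TensorProduct.assoc k A H H (LinearMap.rTensor H
        (LinearMap.lTensor A (σ : H →ₗ[k] H) ∘ₗ α.coact) (LinearMap.lTensor A (σ : H →ₗ[k] H) t)) =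
        TensorProduct.map LinearMap.id (TensorProduct.map (σ : H →ₗ[k] H)
      (σ : H →ₗ[k] H)) (TensorProduct.assoc k A H H (LinearMap.rTensor H α.coact t)) := by
      intro t
      induction t with
      | zero => simp
      | add a b ha hb => simp only [map_add, ha, hb]
      | tmul a h =>
        simp only [LinearMap.lTensor_tmul, LinearMap.rTensor_tmul, LinearMap.comp_apply]
        induction α.coact a with
        | zero => simp
        | add a b ha hb => simp only [map_add, TensorProduct.add_tmul, ha, hb]
        | tmul a l => simp
    have h2 : ∀ t : A ⊗[k] H, LinearMap.lTensor A Coalgebra.comul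
        (LinearMap.lTensor A (σ : H →ₗ[k] H) t) =
        TensorProduct.map LinearMap.id (TensorProduct.map (σ : H →ₗ[k] H)
      (σ : H →ₗ[k] H)) (LinearMap.lTensor A Coalgebra.comul t) := by
      intro t
      induction t with
      | zero => simp
      | add a b ha hb => simp only [map_add, ha, hb]
      | tmul a h => simp
    rw [LinearMap.comp_apply, h1, h, h2]
  counit_coact v := by
    conv_rhs => rw [← α.counit_coact v]
    rw [LinearMap.comp_apply]
    induction α.coact v with
    | zero => simp
    | add a b ha hb => simp only [map_add, ha, hb]
    | tmul a h => simp
  coact_mul a b := by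
    simp only [LinearMap.comp_apply, α.coact_mul]
    induction α.coact a with
    | zero => simp
    | add a b ha hb => simp only [add_mul, map_add, ha, hb]
    | tmul a h =>
      induction α.coact b with
      | zero => simp
      | add a b ha hb => simp only [mul_add, map_add, ha, hb]
      | tmul b l => simp

end Coaction

section SmashDual
variable {k : Type u} {H : Type v} [Field k] [Ring H] [HopfAlgebra k H]
variable {A : Type w} [NonUnitalRing A] [Module k A] [IsScalarTower k A A] [SMulCommClass k A A]

/-- The underlying vector space `A ⊗ Ĥ` of the smash product `A # Ĥ`. -/
@[nolint unusedArguments]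
def SmashDual (_α : Coaction k H A) (F : InvariantFunctionals k H) : Type (max u v w) :=
  A ⊗[k] dualHat F

namespace SmashDual
variable (α : Coaction k H A) (F : InvariantFunctionals k H)

instance : AddCommGroup (SmashDual α F) := inferInstanceAs (AddCommGroup (A ⊗[k] dualHat F))
instance : Module k (SmashDual α F) := inferInstanceAs (Module k (A ⊗[k] dualHat F))

/-- `hatCross F ω χ h = ω(h -) * χ`. -/
def hatCross : dualHat F →ₗ[k] dualHat F →ₗ[k] H →ₗ[k] dualHat F :=
  LinearMap.mk₂ k (fun ω χ => (LinearMap.mul k (dualHat F)).flip χ ∘ₗ hatShift F ω)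
    (fun _ _ _ => LinearMap.ext fun _ => by simp)
    (fun _ _ _ => LinearMap.ext fun _ => by simp)
    (fun _ _ _ => LinearMap.ext fun _ => by simp)
    (fun _ _ _ => LinearMap.ext fun _ => by simp)

@[simp] theorem hatCross_apply (ω χ : dualHat F) (h : H) :
    hatCross F ω χ h = hatShift F ω h * χ := rfl

/-- The product of `A # Ĥ`, `(a # ω) (b # χ) = a b₍₀₎ # ω(b₍₁₎ -) * χ`. -/
def mulMap : A ⊗[k] dualHat F →ₗ[k] A ⊗[k] dualHat F →ₗ[k] A ⊗[k] dualHat F :=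
  TensorProduct.lift (LinearMap.mk₂ k
    (fun a ω => TensorProduct.lift (LinearMap.mk₂ k
      (fun b χ => TensorProduct.map (LinearMap.mul k A a) (hatCross F ω χ) (α.coact b))
      (fun _ _ _ => by simp)
      (fun _ _ _ => by simp)
      (fun _ _ _ => by simp [TensorProduct.map_add_right])
      (fun _ _ _ => by simp [TensorProduct.map_smul_right])))
    (fun _ _ _ => TensorProduct.ext' fun _ _ => by simp [TensorProduct.map_add_left])
    (fun _ _ _ => TensorProduct.ext' fun _ _ => by simp [TensorProduct.map_smul_left])
    (fun _ _ _ => TensorProduct.ext' fun _ _ => by simp [TensorProduct.map_add_right])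
    (fun _ _ _ => TensorProduct.ext' fun _ _ => by simp [TensorProduct.map_smul_right]))

theorem mulMap_tmul (a b : A) (ω χ : dualHat F) :
    mulMap α F (a ⊗ₜ ω) (b ⊗ₜ χ) =
      TensorProduct.map (LinearMap.mul k A a) (hatCross F ω χ) (α.coact b) := rfl

theorem mulMap_assoc_tmul (a b c : A) (ω χ θ : dualHat F) :
    mulMap α F (mulMap α F (a ⊗ₜ ω) (b ⊗ₜ χ)) (c ⊗ₜ θ) =
      mulMap α F (a ⊗ₜ ω) (mulMap α F (b ⊗ₜ χ) (c ⊗ₜ θ)) := by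
  -- `T s ((c ⊗ h) ⊗ l) = ∑ a s' c ⊗ ω(s'' h -) * χ(l -) * θ`
  let T (s : A ⊗[k] H) : (A ⊗[k] H) ⊗[k] H →ₗ[k] A ⊗[k] dualHat F :=
    TensorProduct.lift (LinearMap.mk₂ k
      (fun u l => TensorProduct.map (LinearMap.mul k A a) (hatCross F ω (hatCross F χ θ l))
        (s * u))
      (fun _ _ _ => by simp [mul_add])
      (fun _ _ _ => by rw [mul_smul_comm, map_smul])
      (fun _ _ _ => by simp [TensorProduct.map_add_right, add_mul])
      (fun _ _ _ => by
        rw [map_smul, map_smul, TensorProduct.map_smul_right, LinearMap.smul_apply]))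
  have hT : ∀ s u l, T s (u ⊗ₜ l) = TensorProduct.map (LinearMap.mul k A a)
      (hatCross F ω (hatCross F χ θ l)) (s * u) := fun s u l => rfl
  have hr : ∀ t : A ⊗[k] H, mulMap α F (a ⊗ₜ ω)
      (TensorProduct.map (LinearMap.mul k A b) (hatCross F χ θ) t) =
      T (α.coact b) (LinearMap.rTensor H α.coact t) := by
    intro t
    induction t with
    | zero => simp
    | add x y hx hy => simp only [map_add, hx, hy]
    | tmul c h => simp [hT, mulMap_tmul, α.coact_mul]
  have hl : ∀ s : A ⊗[k] H,
      mulMap α F (TensorProduct.map (LinearMap.mul k A a) (hatCross F ω χ) s) (c ⊗ₜ θ) =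
      T s ((TensorProduct.assoc k A H H).symm
        (LinearMap.lTensor A Coalgebra.comul (α.coact c))) := by
    intro s
    induction s with
    | zero =>
      have h0 : T 0 = 0 := TensorProduct.ext' fun u l => by simp [hT]
      simp [h0]
    | add x y hx hy =>
      have h0 : T (x + y) = T x + T y := TensorProduct.ext' fun u l => by simp [hT, add_mul]
      simp only [map_add, LinearMap.add_apply, hx, hy, h0]
    | tmul b m =>
      rw [TensorProduct.map_tmul, mulMap_tmul]
      induction α.coact c with
      | zero => simp
      | add x y hx hy => simp only [map_add, hx, hy]
      | tmul c h =>
        simp only [TensorProduct.map_tmul, LinearMap.lTensor_tmul, hatCross_apply, hatShift_mul,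
          LinearMap.mul_apply']
        induction Coalgebra.comul (R := k) h with
        | zero => simp
        | add x y hx hy => simp only [map_add, TensorProduct.tmul_add, add_mul, hx, hy]
        | tmul p q => simp [hT, hatShift_hatShift, mul_assoc]
  rw [mulMap_tmul, mulMap_tmul, hr, hl, ← α.coassoc, LinearEquiv.symm_apply_apply]

theorem mulMap_assoc (x y z : A ⊗[k] dualHat F) :
    mulMap α F (mulMap α F x y) z = mulMap α F x (mulMap α F y z) := by
  induction x with
  | zero => simp
  | add x x' hx hx' => simp only [map_add, LinearMap.add_apply, hx, hx']
  | tmul a ω =>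
    induction y with
    | zero => simp
    | add x x' hx hx' => simp only [map_add, LinearMap.add_apply, hx, hx']
    | tmul b χ =>
      induction z with
      | zero => simp
      | add x x' hx hx' => simp only [map_add, hx, hx']
      | tmul c θ => exact mulMap_assoc_tmul α F a b c ω χ θ

/-- The smash product algebra `A # Ĥ`. -/
instance : NonUnitalRing (SmashDual α F) :=
  { (inferInstance : AddCommGroup (SmashDual α F)) with
    mul := fun x y => mulMap α F x y
    left_distrib := fun x y z => map_add (mulMap α F x) y z
    right_distrib := fun x y z => LinearMap.map_add₂ (mulMap α F) x y z
    zero_mul := fun x => LinearMap.map_zero₂ (mulMap α F) x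
    mul_zero := fun x => map_zero (mulMap α F x)
    mul_assoc := mulMap_assoc α F }

instance : IsScalarTower k (SmashDual α F) (SmashDual α F) :=
  ⟨fun c x y => LinearMap.map_smul₂ (mulMap α F) c x y⟩

instance : SMulCommClass k (SmashDual α F) (SmashDual α F) :=
  ⟨fun c x y => (map_smul (mulMap α F x) c y).symm⟩

/-- The action `h · (a # ω) = a # ω(- h)` as a linear map. -/
def actMap : H →ₗ[k] A ⊗[k] dualHat F →ₗ[k] A ⊗[k] dualHat F :=
  LinearMap.lTensorHom A ∘ₗ hatRshift F

theorem actMap_tmul (h : H) (a : A) (ω : dualHat F) :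
    actMap F h (a ⊗ₜ[k] ω) = a ⊗ₜ hatRshift F h ω := rfl

/-- `(p ⊗ q) ↦ ((x, y) ↦ (p · x) (q · y))`. -/
def actMul : H ⊗[k] H →ₗ[k] A ⊗[k] dualHat F →ₗ[k] A ⊗[k] dualHat F →ₗ[k] A ⊗[k] dualHat F :=
  TensorProduct.lift (LinearMap.mk₂ k
    (fun p q => (mulMap α F).compl₁₂ (actMap F p) (actMap F q))
    (fun _ _ _ => by ext; simp) (fun _ _ _ => by ext; simp)
    (fun _ _ _ => by ext; simp) (fun _ _ _ => by ext; simp))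

theorem actMul_tmul (p q : H) (x y : A ⊗[k] dualHat F) :
    actMul α F (p ⊗ₜ q) x y = mulMap α F (actMap F p x) (actMap F q y) := rfl

theorem actMap_mul_tmul (h : H) (a b : A) (ω χ : dualHat F) :
    actMap F h (mulMap α F (a ⊗ₜ ω) (b ⊗ₜ χ)) =
      actMul α F (Coalgebra.comul h) (a ⊗ₜ ω) (b ⊗ₜ χ) := by
  let V : H ⊗[k] H →ₗ[k] A ⊗[k] H →ₗ[k] A ⊗[k] dualHat F :=
    TensorProduct.lift (LinearMap.mk₂ k
      (fun p q => TensorProduct.map (LinearMap.mul k A a)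
        (hatCross F (hatRshift F p ω) (hatRshift F q χ)))
      (fun _ _ _ => by simp [TensorProduct.map_add_right])
      (fun _ _ _ => by simp [TensorProduct.map_smul_right])
      (fun _ _ _ => by simp [TensorProduct.map_add_right])
      (fun _ _ _ => by simp [TensorProduct.map_smul_right]))
  have hV : ∀ p q, V (p ⊗ₜ q) = TensorProduct.map (LinearMap.mul k A a)
      (hatCross F (hatRshift F p ω) (hatRshift F q χ)) := fun p q => rfl
  have h1 : ∀ s : H ⊗[k] H, actMul α F s (a ⊗ₜ ω) (b ⊗ₜ χ) = V s (α.coact b) := by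
    intro s
    induction s with
    | zero => simp only [map_zero, LinearMap.zero_apply]
    | add x y hx hy => simp only [map_add, LinearMap.add_apply, hx, hy]
    | tmul p q => rfl
  have h2 : ∀ t : A ⊗[k] H, actMap F h (TensorProduct.map (LinearMap.mul k A a)
      (hatCross F ω χ) t) = V (Coalgebra.comul h) t := by
    intro t
    induction t with
    | zero => simp only [map_zero]
    | add x y hx hy => simp only [map_add, hx, hy]
    | tmul b m =>
      rw [TensorProduct.map_tmul, actMap_tmul, hatCross_apply, hatRshift_mul]
      induction Coalgebra.comul (R := k) h with
      | zero => simp only [map_zero, TensorProduct.tmul_zero, LinearMap.zero_apply]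
      | add x y hx hy => simp only [map_add, TensorProduct.tmul_add, LinearMap.add_apply, hx, hy]
      | tmul p q => simp [hV, hatRshift_hatShift]
  rw [h1, mulMap_tmul, h2]

theorem actMap_mul (h : H) (x y : A ⊗[k] dualHat F) :
    actMap F h (mulMap α F x y) = actMul α F (Coalgebra.comul h) x y := by
  induction x with
  | zero => simp only [map_zero, LinearMap.zero_apply]
  | add x x' hx hx' => simp only [map_add, LinearMap.add_apply, hx, hx']
  | tmul a ω =>
    induction y with
    | zero => simp only [map_zero]
    | add x x' hx hx' => simp only [map_add, hx, hx']
    | tmul b χ => exact actMap_mul_tmul α F h a b ω χ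

/-- The left `H`-module algebra structure `h · (a # ω) = a # ω(- h)` on `A # Ĥ`. -/
def action : HopfAction k H (SmashDual α F) where
  act := actMap F
  one_act x := by
    change A ⊗[k] dualHat F at x
    induction x with
    | zero => exact map_zero (actMap F 1)
    | add x y hx hy => exact (map_add (actMap F 1) x y).trans (congrArg₂ (· + ·) hx hy)
    | tmul a ω =>
      have : hatRshift F 1 ω = ω := by ext x; simp [hatRshift]
      exact congrArg (a ⊗ₜ[k] ·) this
  mul_act h l x := by
    change A ⊗[k] dualHat F at x
    change actMap F (h * l) x = actMap F h (actMap F l x)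
    induction x with
    | zero => simp
    | add x y hx hy => simp only [map_add, hx, hy]
    | tmul a ω =>
      have : hatRshift F (h * l) ω = hatRshift F h (hatRshift F l ω) := by
        ext x; simp [hatRshift, mul_assoc]
      exact congrArg (a ⊗ₜ[k] ·) this
  act_mul h x y := by
    refine (actMap_mul α F h x y).trans ?_
    generalize (Coalgebra.comul (R := k) h) = s
    induction s with
    | zero =>
      exact (LinearMap.congr_fun₂ (map_zero (actMul α F)) x y).trans (map_zero _).symm
    | add p q hp hq =>
      exact (LinearMap.congr_fun₂ (map_add (actMul α F) p q) x y).trans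
        ((congrArg₂ (· + ·) hp hq).trans (map_add _ p q).symm)
    | tmul p q => rfl

end SmashDual
end SmashDual

theorem tensor_mul_eq_map₂ {k : Type u} {H : Type v} {A : Type w} [Field k] [Ring H] [Algebra k H]
    [NonUnitalRing A] [Module k A] [IsScalarTower k A A] [SMulCommClass k A A]
    (s t : A ⊗[k] H) :
    s * t = TensorProduct.map₂ (LinearMap.mul k A) (LinearMap.mul k H) s t := by
  induction s with
  | zero => simp
  | add x y hx hy => simp only [add_mul, map_add, LinearMap.add_apply, hx, hy]
  | tmul a h =>
    induction t with
    | zero => simp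
    | add x y hx hy => simp only [mul_add, map_add, hx, hy]
    | tmul b l => simp

section Smash
variable {k : Type u} {H : Type v} [Field k] [Ring H] [HopfAlgebra k H]
variable {B : Type w} [NonUnitalRing B] [Module k B] [IsScalarTower k B B] [SMulCommClass k B B]

/-- The underlying vector space `B ⊗ H` of the smash product `B # H`. -/
@[nolint unusedArguments]
def Smash (_ρ : HopfAction k H B) : Type (max v w) := B ⊗[k] H

namespace Smash
variable (ρ : HopfAction k H B)

instance : AddCommGroup (Smash ρ) := inferInstanceAs (AddCommGroup (B ⊗[k] H))
instance : Module k (Smash ρ) := inferInstanceAs (Module k (B ⊗[k] H))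

/-- `cross ρ x y h = x (h · y)`. -/
def cross : B →ₗ[k] B →ₗ[k] H →ₗ[k] B :=
  LinearMap.mk₂ k (fun x y => LinearMap.mul k B x ∘ₗ ρ.act.flip y)
    (fun _ _ _ => LinearMap.ext fun _ => by simp)
    (fun _ _ _ => LinearMap.ext fun _ => by simp)
    (fun _ _ _ => LinearMap.ext fun _ => by simp [mul_add])
    (fun _ _ _ => LinearMap.ext fun _ => by simp)

@[simp] theorem cross_apply (x y : B) (h : H) : cross ρ x y h = x * ρ.act h y := rfl

/-- The product of `B # H`, `(x # h) (y # l) = x (h₍₁₎ · y) # h₍₂₎ l`. -/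
def mulMap : B ⊗[k] H →ₗ[k] B ⊗[k] H →ₗ[k] B ⊗[k] H :=
  TensorProduct.lift (LinearMap.mk₂ k
    (fun x h => TensorProduct.lift (LinearMap.mk₂ k
      (fun y l => TensorProduct.map (cross ρ x y) ((LinearMap.mul k H).flip l)
        (Coalgebra.comul h))
      (fun _ _ _ => by simp [TensorProduct.map_add_left])
      (fun _ _ _ => by simp [TensorProduct.map_smul_left])
      (fun _ _ _ => by simp [TensorProduct.map_add_right])
      (fun _ _ _ => by simp [TensorProduct.map_smul_right])))
    (fun _ _ _ => TensorProduct.ext' fun _ _ => by simp [TensorProduct.map_add_left])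
    (fun _ _ _ => TensorProduct.ext' fun _ _ => by simp [TensorProduct.map_smul_left])
    (fun _ _ _ => TensorProduct.ext' fun _ _ => by simp)
    (fun _ _ _ => TensorProduct.ext' fun _ _ => by simp))

theorem mulMap_tmul (x y : B) (h l : H) :
    mulMap ρ (x ⊗ₜ h) (y ⊗ₜ l) =
      TensorProduct.map (cross ρ x y) ((LinearMap.mul k H).flip l) (Coalgebra.comul h) := rfl

theorem mulMap_assoc_tmul (x y z : B) (h l m : H) :
    mulMap ρ (mulMap ρ (x ⊗ₜ h) (y ⊗ₜ l)) (z ⊗ₜ m) =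
      mulMap ρ (x ⊗ₜ h) (mulMap ρ (y ⊗ₜ l) (z ⊗ₜ m)) := by
  -- `T s (p ⊗ u) = ∑ x (p · y) (u₁ s₁ · z) ⊗ u₂ s₂ m`
  let T (s : H ⊗[k] H) : H ⊗[k] (H ⊗[k] H) →ₗ[k] B ⊗[k] H :=
    TensorProduct.lift (LinearMap.mk₂ k
      (fun p u => TensorProduct.map (cross ρ (cross ρ x y p) z) ((LinearMap.mul k H).flip m)
        (u * s))
      (fun _ _ _ => by
        rw [map_add, map_add, LinearMap.add_apply, TensorProduct.map_add_left,
          LinearMap.add_apply])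
      (fun _ _ _ => by
        rw [map_smul, map_smul, LinearMap.smul_apply, TensorProduct.map_smul_left,
          LinearMap.smul_apply])
      (fun _ _ _ => by rw [add_mul, map_add])
      (fun _ _ _ => by rw [smul_mul_assoc, map_smul]))
  have hT : ∀ s p u, T s (p ⊗ₜ u) = TensorProduct.map (cross ρ (cross ρ x y p) z)
      ((LinearMap.mul k H).flip m) (u * s) := fun s p u => rfl
  have hl : ∀ t : H ⊗[k] H, mulMap ρ (TensorProduct.map (cross ρ x y)
      ((LinearMap.mul k H).flip l) t) (z ⊗ₜ m) =
      T (Coalgebra.comul l) (LinearMap.lTensor H Coalgebra.comul t) := by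
    intro t
    induction t with
    | zero => simp
    | add a b ha hb => simp only [map_add, LinearMap.add_apply, ha, hb]
    | tmul p q => simp [hT, mulMap_tmul]
  have hr : ∀ s : H ⊗[k] H, mulMap ρ (x ⊗ₜ h) (TensorProduct.map (cross ρ y z)
      ((LinearMap.mul k H).flip m) s) =
      T s (TensorProduct.assoc k H H H (LinearMap.rTensor H Coalgebra.comul
        (Coalgebra.comul h))) := by
    intro s
    induction s with
    | zero =>
      have h0 : T 0 = 0 := TensorProduct.ext' fun u l => by simp [hT]
      simp [h0]
    | add a b ha hb =>
      have h0 : T (a + b) = T a + T b := TensorProduct.ext' fun u l => by simp [hT, mul_add]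
      simp only [map_add, LinearMap.add_apply, ha, hb, h0]
    | tmul r n =>
      rw [TensorProduct.map_tmul, mulMap_tmul]
      induction Coalgebra.comul (R := k) h with
      | zero => simp
      | add a b ha hb => simp only [map_add, ha, hb]
      | tmul p q =>
        rw [TensorProduct.map_tmul, LinearMap.rTensor_tmul, cross_apply, cross_apply, ρ.act_mul]
        induction Coalgebra.comul (R := k) p with
        | zero => simp
        | add a b ha hb =>
          simp only [map_add, TensorProduct.add_tmul, mul_add, ← ha, ← hb]
        | tmul a b => simp [hT, ρ.mul_act, mul_assoc]
  rw [mulMap_tmul, mulMap_tmul, hr, hl, Coalgebra.coassoc_apply]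

theorem mulMap_assoc (x y z : B ⊗[k] H) :
    mulMap ρ (mulMap ρ x y) z = mulMap ρ x (mulMap ρ y z) := by
  induction x with
  | zero => simp
  | add x x' hx hx' => simp only [map_add, LinearMap.add_apply, hx, hx']
  | tmul a h =>
    induction y with
    | zero => simp
    | add x x' hx hx' => simp only [map_add, LinearMap.add_apply, hx, hx']
    | tmul b l =>
      induction z with
      | zero => simp
      | add x x' hx hx' => simp only [map_add, hx, hx']
      | tmul c m => exact mulMap_assoc_tmul ρ a b c h l m

/-- The smash product algebra `B # H`. -/
instance : NonUnitalRing (Smash ρ) :=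
  { (inferInstance : AddCommGroup (Smash ρ)) with
    mul := fun x y => mulMap ρ x y
    left_distrib := fun x y z => map_add (mulMap ρ x) y z
    right_distrib := fun x y z => LinearMap.map_add₂ (mulMap ρ) x y z
    zero_mul := fun x => LinearMap.map_zero₂ (mulMap ρ) x
    mul_zero := fun x => map_zero (mulMap ρ x)
    mul_assoc := mulMap_assoc ρ }

instance : IsScalarTower k (Smash ρ) (Smash ρ) :=
  ⟨fun c x y => LinearMap.map_smul₂ (mulMap ρ) c x y⟩

instance : SMulCommClass k (Smash ρ) (Smash ρ) :=
  ⟨fun c x y => (map_smul (mulMap ρ x) c y).symm⟩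

variable (k H B) in
/-- `x ⊗ h ↦ (x ⊗ h₍₁₎) ⊗ h₍₂₎`. -/
def coactMap : B ⊗[k] H →ₗ[k] (B ⊗[k] H) ⊗[k] H :=
  (TensorProduct.assoc k B H H).symm.toLinearMap ∘ₗ LinearMap.lTensor B Coalgebra.comul

theorem coactMap_mul_tmul (x y : B) (h l : H) :
    coactMap k H B (mulMap ρ (x ⊗ₜ h) (y ⊗ₜ l)) =
      TensorProduct.map₂ (mulMap ρ) (LinearMap.mul k H)
        (coactMap k H B (x ⊗ₜ h)) (coactMap k H B (y ⊗ₜ l)) := by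
  -- `T s (p ⊗ u) = ∑ (x (p · y) ⊗ u₁ s₁) ⊗ u₂ s₂`
  let T (s : H ⊗[k] H) : H ⊗[k] (H ⊗[k] H) →ₗ[k] (B ⊗[k] H) ⊗[k] H :=
    (TensorProduct.assoc k B H H).symm.toLinearMap ∘ₗ
      TensorProduct.map (cross ρ x y) ((LinearMap.mul k (H ⊗[k] H)).flip s)
  have hT : ∀ s p u, T s (p ⊗ₜ u) =
      (TensorProduct.assoc k B H H).symm ((x * ρ.act p y) ⊗ₜ (u * s)) := fun s p u => rfl
  have hl : ∀ t : H ⊗[k] H, coactMap k H B (TensorProduct.map (cross ρ x y)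
      ((LinearMap.mul k H).flip l) t) =
      T (Coalgebra.comul l) (LinearMap.lTensor H Coalgebra.comul t) := by
    intro t
    induction t with
    | zero => simp
    | add a b ha hb => simp only [map_add, ha, hb]
    | tmul p q => simp [hT, coactMap]
  have hr : ∀ s t : H ⊗[k] H, TensorProduct.map₂ (mulMap ρ) (LinearMap.mul k H)
        ((TensorProduct.assoc k B H H).symm (x ⊗ₜ t))
        ((TensorProduct.assoc k B H H).symm (y ⊗ₜ s)) =
      T s (TensorProduct.assoc k H H H (LinearMap.rTensor H Coalgebra.comul t)) := by
    intro s t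
    induction s with
    | zero =>
      have h0 : T 0 = 0 := TensorProduct.ext' fun u l => by simp [hT]
      simp [h0]
    | add a b ha hb =>
      have h0 : T (a + b) = T a + T b := TensorProduct.ext' fun u l => by
        simp [hT, mul_add, TensorProduct.tmul_add]
      simp only [TensorProduct.tmul_add, map_add, LinearMap.add_apply, ha, hb, h0]
    | tmul r n =>
      induction t with
      | zero => simp
      | add a b ha hb => simp only [TensorProduct.tmul_add, map_add, LinearMap.add_apply, ha, hb]
      | tmul p q =>
        rw [TensorProduct.assoc_symm_tmul, TensorProduct.assoc_symm_tmul,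
          TensorProduct.map₂_apply_tmul, TensorProduct.map_tmul, mulMap_tmul, LinearMap.rTensor_tmul]
        induction Coalgebra.comul (R := k) p with
        | zero => simp
        | add a b ha hb => simp only [map_add, TensorProduct.add_tmul, ha, hb]
        | tmul a b => simp [hT]
  have e1 : coactMap k H B (x ⊗ₜ h) =
    (TensorProduct.assoc k B H H).symm (x ⊗ₜ Coalgebra.comul h) := rfl
  have e2 : coactMap k H B (y ⊗ₜ l) =
    (TensorProduct.assoc k B H H).symm (y ⊗ₜ Coalgebra.comul l) := rfl
  rw [e1, e2, hr, mulMap_tmul, hl, Coalgebra.coassoc_apply]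

theorem coactMap_mul (x y : B ⊗[k] H) :
    coactMap k H B (mulMap ρ x y) =
      TensorProduct.map₂ (mulMap ρ) (LinearMap.mul k H) (coactMap k H B x) (coactMap k H B y) := by
  induction x with
  | zero => simp
  | add x x' hx hx' => simp only [map_add, LinearMap.add_apply, hx, hx']
  | tmul a h =>
    induction y with
    | zero => simp
    | add x x' hx hx' => simp only [map_add, hx, hx']
    | tmul b l => exact coactMap_mul_tmul ρ a b h l

/-- The dual coaction `x # h ↦ (x # h₍₁₎) ⊗ h₍₂₎` on `B # H`. -/
def dualCoaction : Coaction k H (Smash ρ) where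
  coact := coactMap k H B
  coassoc x := by
    change B ⊗[k] H at x
    change TensorProduct.assoc k (B ⊗[k] H) H H
      (LinearMap.rTensor H (coactMap k H B) (coactMap k H B x)) =
        LinearMap.lTensor (B ⊗[k] H) Coalgebra.comul (coactMap k H B x)
    induction x with
    | zero => simp
    | add x y hx hy => simp only [map_add, hx, hy]
    | tmul b h =>
      have h1 : ∀ t : H ⊗[k] H, TensorProduct.assoc k (B ⊗[k] H) H H
          (LinearMap.rTensor H (coactMap k H B) ((TensorProduct.assoc k B H H).symm (b ⊗ₜ t))) =
          (TensorProduct.assoc k B H (H ⊗[k] H)).symm (b ⊗ₜ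
            TensorProduct.assoc k H H H (LinearMap.rTensor H Coalgebra.comul t)) := by
        intro t
        induction t with
        | zero => simp
        | add x y hx hy => simp only [TensorProduct.tmul_add, map_add, hx, hy]
        | tmul p q =>
          simp only [TensorProduct.assoc_symm_tmul, LinearMap.rTensor_tmul, coactMap,
            LinearMap.comp_apply, LinearMap.lTensor_tmul, LinearEquiv.coe_coe]
          induction Coalgebra.comul (R := k) p with
          | zero => simp
          | add x y hx hy =>
            simp only [TensorProduct.tmul_add, TensorProduct.add_tmul, map_add, hx, hy]
          | tmul a b => simp
      have h2 : ∀ t : H ⊗[k] H, LinearMap.lTensor (B ⊗[k] H) Coalgebra.comul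
          ((TensorProduct.assoc k B H H).symm (b ⊗ₜ t)) =
          (TensorProduct.assoc k B H (H ⊗[k] H)).symm (b ⊗ₜ
            LinearMap.lTensor H Coalgebra.comul t) := by
        intro t
        induction t with
        | zero => simp
        | add x y hx hy => simp only [TensorProduct.tmul_add, map_add, hx, hy]
        | tmul p q => simp
      refine (h1 _).trans ((?_ : _ = _).trans (h2 _).symm)
      rw [Coalgebra.coassoc_apply]
  counit_coact x := by
    change B ⊗[k] H at x
    change TensorProduct.rid k (B ⊗[k] H)
      (LinearMap.lTensor (B ⊗[k] H) Coalgebra.counit (coactMap k H B x)) = x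
    induction x with
    | zero => simp
    | add x y hx hy => simp only [map_add, hx, hy]
    | tmul b h =>
      have h1 : ∀ t : H ⊗[k] H, TensorProduct.rid k (B ⊗[k] H)
          (LinearMap.lTensor (B ⊗[k] H) Coalgebra.counit
            ((TensorProduct.assoc k B H H).symm (b ⊗ₜ t))) =
          b ⊗ₜ TensorProduct.rid k H (LinearMap.lTensor H Coalgebra.counit t) := by
        intro t
        induction t with
        | zero => simp
        | add x y hx hy => simp only [TensorProduct.tmul_add, map_add, hx, hy]
        | tmul p q => simp
      refine (h1 _).trans ?_
      simp
  coact_mul x y := by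
    rw [tensor_mul_eq_map₂]
    exact coactMap_mul ρ x y

end Smash
end Smash

section Antipode
variable {k : Type u} {H : Type v} [Field k] [Ring H] [HopfAlgebra k H]

theorem comul_antipode (h : H) : Coalgebra.comul (HopfAlgebra.antipode k h) =
    TensorProduct.map (HopfAlgebra.antipode k) (HopfAlgebra.antipode k)
      (TensorProduct.comm k H H (Coalgebra.comul h)) := by
  let S : H →ₗ[k] H := HopfAlgebra.antipode k
  let Δ : H →ₗ[k] H ⊗[k] H := Coalgebra.comul
  let G : H →ₗ[k] H ⊗[k] H := TensorProduct.map S S ∘ₗ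
    (TensorProduct.comm k H H).toLinearMap ∘ₗ Coalgebra.comul
  have h1 : WithConv.toConv G * WithConv.toConv (Coalgebra.comul (R := k) (A := H)) = 1 := by
    -- `T (a ⊗ (b ⊗ w)) = (S b ⊗ S a) * w`
    let T : H ⊗[k] (H ⊗[k] (H ⊗[k] H)) →ₗ[k] H ⊗[k] H :=
      LinearMap.mul' k (H ⊗[k] H) ∘ₗ
        LinearMap.rTensor _ (TensorProduct.map S S ∘ₗ (TensorProduct.comm k H H).toLinearMap) ∘ₗ
        (TensorProduct.assoc k H H (H ⊗[k] H)).symm.toLinearMap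
    have hT : ∀ a b w, T (a ⊗ₜ (b ⊗ₜ w)) = (S b ⊗ₜ S a) * w := fun a b w => by simp [T]
    have e1 : ∀ t : H ⊗[k] H, LinearMap.mul' k (H ⊗[k] H) (TensorProduct.map G Δ t) =
        T (LinearMap.lTensor H (LinearMap.lTensor H Δ)
          (TensorProduct.assoc k H H H (LinearMap.rTensor H Δ t))) := by
      intro t
      induction t with
      | zero => simp
      | add x y hx hy => simp only [map_add, hx, hy]
      | tmul p q =>
        simp only [TensorProduct.map_tmul, G, LinearMap.comp_apply, LinearMap.rTensor_tmul, Δ]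
        induction Coalgebra.comul (R := k) p with
        | zero => simp
        | add x y hx hy =>
          simp only [map_add, TensorProduct.add_tmul, hx, hy]
        | tmul a b => simp [hT]
    have e3 : ∀ (p : H) (t : H ⊗[k] H), T (p ⊗ₜ TensorProduct.assoc k H H H
        (LinearMap.rTensor H Δ t)) =
        1 ⊗ₜ (S p * TensorProduct.lid k H (LinearMap.rTensor H Coalgebra.counit t)) := by
      intro p t
      induction t with
      | zero => simp
      | add x y hx hy => simp only [map_add, TensorProduct.tmul_add, mul_add, hx, hy]
      | tmul c d =>
        have e4 : ∀ s : H ⊗[k] H, T (p ⊗ₜ TensorProduct.assoc k H H H (s ⊗ₜ d)) =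
            (LinearMap.mul' k H (LinearMap.rTensor H S s)) ⊗ₜ (S p * d) := by
          intro s
          induction s with
          | zero => simp
          | add x y hx hy => simp only [map_add, TensorProduct.add_tmul, TensorProduct.tmul_add,
              hx, hy]
          | tmul a b => simp [hT]
        rw [LinearMap.rTensor_tmul, e4]
        simp only [S, Δ]
        rw [HopfAlgebra.mul_antipode_rTensor_comul_apply]
        simp [Algebra.algebraMap_eq_smul_one, TensorProduct.smul_tmul]
    have e2 : ∀ t : H ⊗[k] H, T (LinearMap.lTensor H (LinearMap.lTensor H Δ)
        (LinearMap.lTensor H Δ t)) = 1 ⊗ₜ LinearMap.mul' k H (LinearMap.rTensor H S t) := by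
      intro t
      induction t with
      | zero => simp
      | add x y hx hy => simp only [map_add, TensorProduct.tmul_add, hx, hy]
      | tmul p q =>
        rw [LinearMap.lTensor_tmul, LinearMap.lTensor_tmul]
        simp only [Δ]
        rw [← Coalgebra.coassoc_apply, e3]
        simp
    refine WithConv.ext (LinearMap.ext fun x => ?_)
    refine (e1 (Coalgebra.comul x)).trans ?_
    simp only [Δ]
    rw [Coalgebra.coassoc_apply, e2]
    simp only [S]
    rw [HopfAlgebra.mul_antipode_rTensor_comul_apply]
    simp [LinearMap.convOne_def, Algebra.algebraMap_eq_smul_one, Algebra.TensorProduct.one_def]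
  have h2 := left_inv_eq_right_inv h1 LinearMap.comul_right_inv
  exact (LinearMap.congr_fun (congrArg WithConv.ofConv h2) h).symm

variable (k H) in
/-- The square of the antipode, as a homomorphism of bialgebras. -/
def antipodeSq : H →ₐc[k] H :=
  BialgHom.ofAlgHom
    (AlgHom.ofLinearMap (HopfAlgebra.antipode k ∘ₗ HopfAlgebra.antipode k)
      (by simp) (by simp [HopfAlgebra.antipode_mul_antidistrib]))
    (by ext; simp)
    (by
      refine AlgHom.ext fun h => ?_
      have e : ∀ t : H ⊗[k] H, TensorProduct.map (HopfAlgebra.antipode k) (HopfAlgebra.antipode k)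
          (TensorProduct.comm k H H (TensorProduct.map (HopfAlgebra.antipode k)
            (HopfAlgebra.antipode k) (TensorProduct.comm k H H t))) =
          TensorProduct.map (HopfAlgebra.antipode k ∘ₗ HopfAlgebra.antipode k)
            (HopfAlgebra.antipode k ∘ₗ HopfAlgebra.antipode k) t := by
        intro t
        induction t with
        | zero => simp
        | add x y hx hy => simp only [map_add, hx, hy]
        | tmul a b => simp
      refine Eq.trans ?_ (comul_antipode (HopfAlgebra.antipode k h)).symm
      rw [comul_antipode, e]
      rfl)

@[simp] theorem antipodeSq_apply (h : H) :
    antipodeSq k H h = HopfAlgebra.antipode k (HopfAlgebra.antipode k h) := rfl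

end Antipode

section Morita

/-- A Morita context: vector spaces `X i j` for `i, j ∈ {0, 1}` with associative bilinear
multiplication maps `X i j × X j l → X i l`. -/
structure MoritaContext (k : Type u) [Field k] where
  X : Fin 2 → Fin 2 → Type w
  [addCommGroup : ∀ i j, AddCommGroup (X i j)]
  [module : ∀ i j, Module k (X i j)]
  mul : ∀ i j l, X i j →ₗ[k] X j l →ₗ[k] X i l
  mul_assoc : ∀ i j l m (x : X i j) (y : X j l) (z : X l m),
    mul i l m (mul i j l x y) z = mul i j m x (mul j l m y z)

namespace MoritaContext
variable {k : Type u} [Field k] (C : MoritaContext.{u, w} k)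

instance (i j : Fin 2) : AddCommGroup (C.X i j) := C.addCommGroup i j
instance (i j : Fin 2) : Module k (C.X i j) := C.module i j

/-- The span of the elements `x y ⊗ z - x ⊗ y z`, with `x ∈ X i j`, `y ∈ X j j`, `z ∈ X j i`. -/
def balancing (i j : Fin 2) : Submodule k (C.X i j ⊗[k] C.X j i) :=
  Submodule.span k {t | ∃ (x : C.X i j) (y : C.X j j) (z : C.X j i),
    t = C.mul i j j x y ⊗ₜ z - x ⊗ₜ C.mul j j i y z}

/-- The multiplication map on the balanced tensor product of `X i j` and `X j i` over `X j j`. -/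
def balancedMul (i j : Fin 2) : (C.X i j ⊗[k] C.X j i) ⧸ C.balancing i j →ₗ[k] C.X i i :=
  (C.balancing i j).liftQ (TensorProduct.lift (C.mul i j i)) (by
    rw [balancing, Submodule.span_le]
    rintro _ ⟨x, y, z, rfl⟩
    simp [C.mul_assoc])

/-- The context is strict if the four multiplication maps `X i j ⊗ X j i → X i i`, with the tensor
product taken over `X j j`, are isomorphisms. -/
def IsStrict : Prop := ∀ i j, Function.Bijective (C.balancedMul i j)

end MoritaContext

variable (k : Type u) (H : Type v) [Field k] [Ring H] [HopfAlgebra k H]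

/-- An `H`-equivariant Morita context: the spaces are right `H`-comodules, and the multiplication
maps are comodule morphisms, `(x y)₍₀₎ ⊗ (x y)₍₁₎ = x₍₀₎ y₍₀₎ ⊗ x₍₁₎ y₍₁₎`. -/
structure EquivariantMoritaContext extends MoritaContext.{u, w} k where
  comodule : ∀ i j, RightComodule k H (toMoritaContext.X i j)
  coact_mul : ∀ i j l (x : toMoritaContext.X i j) (y : toMoritaContext.X j l),
    (comodule i l).coact (toMoritaContext.mul i j l x y) =
      TensorProduct.map₂ (toMoritaContext.mul i j l) (LinearMap.mul k H)
        ((comodule i j).coact x) ((comodule j l).coact y)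

variable {k H}
variable {A : Type w} [NonUnitalRing A] [Module k A] [IsScalarTower k A A] [SMulCommClass k A A]
variable {B : Type w'} [NonUnitalRing B] [Module k B] [IsScalarTower k B B] [SMulCommClass k B B]

/-- An isomorphism of `H`-comodule algebras from `(A, α)` onto the diagonal entry `X i i`. -/
structure CornerIso (α : Coaction k H A) (C : EquivariantMoritaContext k H) (i : Fin 2) where
  toEquiv : A ≃ₗ[k] C.X i i
  map_mul : ∀ a b : A, toEquiv (a * b) = C.mul i i i (toEquiv a) (toEquiv b)
  map_coact : ∀ a : A, (C.comodule i i).coact (toEquiv a) =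
    LinearMap.rTensor H (toEquiv : A →ₗ[k] C.X i i) (α.coact a)

/-- `(A, α)` and `(B, β)` are `H`-equivariantly Morita equivalent if they are the diagonal entries
of a strict `H`-equivariant Morita context. -/
def EquivariantlyMoritaEquivalent (α : Coaction k H A) (β : Coaction k H B) : Prop :=
  ∃ C : EquivariantMoritaContext.{u, v, max w w'} k H,
    C.IsStrict ∧ Nonempty (CornerIso α C 0) ∧ Nonempty (CornerIso β C 1)

end Morita

section Bidual
variable {k : Type u} {H : Type v} [Field k] [Ring H] [HopfAlgebra k H]
variable {A : Type w} [NonUnitalRing A] [Module k A] [IsScalarTower k A A] [SMulCommClass k A A]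

/-- The double smash product `(A # Ĥ) # H`. -/
abbrev DoubleSmash (α : Coaction k H A) (F : InvariantFunctionals k H) : Type (max u v w) :=
  Smash (SmashDual.action α F)

/-- The `S²`-twisted dual coaction `x # h ↦ (x # h₍₁₎) ⊗ S²(h₍₂₎)` on `(A # Ĥ) # H`. -/
def twistedBidualCoaction (α : Coaction k H A) (F : InvariantFunctionals k H) :
    Coaction k H (DoubleSmash α F) :=
  (Smash.dualCoaction (SmashDual.action α F)).twist (antipodeSq k H)

end Bidual

end EquivMorita

end

/-! Let `M` be a comodule with an invariant bilinear form `p`. The space `(M ⊗ A) ⊗ M` behaves like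
rank-one matrices with coefficients in `A`: a product contracts the two inner copies of `M` with `p`
and multiplies the coefficients. For two such comodules `P 0`, `P 1` the spaces `(P i ⊗ A) ⊗ P j`
form an equivariant Morita context (`rankOneContext`). It is strict because each form takes the
value `1` and `A` has local units (`rankOneContext_isStrict`). Take `P 0 = k`, and `P 1 = H` with
coaction `c ↦ c₍₁₎ ⊗ S²(c₍₂₎)` and form `(h, c) ↦ ψ(h c)`, whose invariance is the right invariance
of `ψ`. The first corner is `A`, so everything comes down to identifying `(H ⊗ A) ⊗ H` with `(A # Ĥ)
# H`.

Heuristically, in multipliers of the double smash product, the isomorphism is `(c ⊗ a) ⊗ h ↦ c ψ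
a₍₀₎ S⁻²(a₍₁₎) h`; rigorously, it is `(a₍₀₎ # ψ(a₍₁₎ - c₍₁₎)) # c₍₂₎ S⁻²(a₍₂₎) h`. It is built in
two stages, `columnEquiv` from `H ⊗ A` to `A # Ĥ` and then `smashEquiv`. Each stage includes a twist
`v ⊗ m ↦ v₍₀₎ ⊗ ρ(v₍₁₎) m`, invertible because `ρ` has a convolution inverse. Products match by the
identity `ψ(p₍₁₎ -) * ψ(- S⁻²(p₍₂₎) d) = ψ(d) ψ(p -)` of `convol_shift_rshift_psi`, which contracts
the middle of a product to the scalar `ψ(h c')`. Coactions match because the `S²` in the twisted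
dual coaction undoes the `S⁻²` in the isomorphism.

These formulas need a bijective antipode and `H ≅ Ĥ` via `c ↦ ψ(- c)`. Both are consequences of the
strong invariance formulas, which move a translate inside `φ` or `ψ` across the comultiplication at
the cost of an antipode. -/

open scoped TensorProduct

noncomputable section

namespace EquivMorita

universe u v w w'

/-! ### Slices of tensors by functionals. -/

section Slices
variable {k : Type*} [Field k] {V W : Type*} [AddCommGroup V] [Module k V] [AddCommGroup W]
  [Module k W]

/-- Evaluation of a functional on the right leg, `v ⊗ w ↦ f(w) v`. -/
def sliceRight (f : Module.Dual k W) : V ⊗[k] W →ₗ[k] V :=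
  (TensorProduct.rid k V).toLinearMap ∘ₗ LinearMap.lTensor V f

@[simp] theorem sliceRight_tmul (f : Module.Dual k W) (v : V) (w : W) :
    sliceRight f (v ⊗ₜ[k] w) = f w • v := by simp [sliceRight]

/-- Evaluation of a functional on the left leg, `v ⊗ w ↦ f(v) w`. -/
def sliceLeft (f : Module.Dual k V) : V ⊗[k] W →ₗ[k] W :=
  (TensorProduct.lid k W).toLinearMap ∘ₗ LinearMap.rTensor W f

@[simp] theorem sliceLeft_tmul (f : Module.Dual k V) (v : V) (w : W) :
    sliceLeft f (v ⊗ₜ[k] w) = f v • w := by simp [sliceLeft]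

/-- Over a field, functionals separate points. Identities in `H` can thus be tested against an
arbitrary `ω`, where they become identities between convolution products. -/
theorem eq_of_forall_dual {x y : V} (h : ∀ f : Module.Dual k V, f x = f y) : x = y := by
  rw [← sub_eq_zero, ← Module.forall_dual_apply_eq_zero_iff k]
  intro f
  rw [map_sub, h, sub_self]

/-- An element of `V ⊗ W` all of whose slices in `W` vanish under the functionals `θ i` is killed by
every linear map that kills the pure tensors `v ⊗ w` with `θ i w = 0` for all `i`. -/
theorem map_eq_zero_of_slices {M ι : Type*} [AddCommGroup M] [Module k M]
    (θ : ι → Module.Dual k W) {t : V ⊗[k] W} (ht : ∀ i, sliceRight (θ i) t = 0)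
    (T : V ⊗[k] W →ₗ[k] M) (hT : ∀ v w, (∀ i, θ i w = 0) → T (v ⊗ₜ w) = 0) : T t = 0 := by
  -- Write `t = ∑ b j ⊗ w j` over a basis of `V`. The slice by `θ i` is `∑ θ i (w j) b j`, so its
  -- vanishing forces `θ i (w j) = 0` for all `j`, and `T` kills each summand separately.
  let b := Module.Basis.ofVectorSpace k V
  obtain ⟨c, rfl⟩ := TensorProduct.eq_repr_basis_left b t
  rw [Finsupp.sum, map_sum]
  refine Finset.sum_eq_zero fun j _ => hT _ _ fun i => ?_
  have h := ht i
  rw [Finsupp.sum, map_sum] at h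
  simp only [sliceRight_tmul] at h
  by_cases hj : j ∈ c.support
  · exact linearIndependent_iff'.1 b.linearIndependent c.support _ h j hj
  · simp [Finsupp.notMem_support_iff.1 hj]

end Slices

/-! ### Coassociativity as a transfer principle for linear maps. -/

section Sweedler
variable {k : Type u} {H : Type v} [Field k] [Ring H] [HopfAlgebra k H]
variable {V : Type*} [AddCommGroup V] [Module k V] {M : Type*} [AddCommGroup M] [Module k M]

/-- Coassociativity, in the form
`∑ T (v₍₀₎ ⊗ (v₍₁₎ ⊗ h)) = ∑ T (v ⊗ (h₍₁₎ ⊗ h₍₂₎))` on the elements of the range of the coaction. -/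
theorem RightComodule.transfer (δ : RightComodule k H V) (T : V ⊗[k] (H ⊗[k] H) →ₗ[k] M)
    {Λ Λ' : V ⊗[k] H →ₗ[k] M}
    (h₁ : ∀ v h, Λ (v ⊗ₜ h) = T (TensorProduct.assoc k V H H (δ.coact v ⊗ₜ h)))
    (h₂ : ∀ v h, T (v ⊗ₜ Coalgebra.comul h) = Λ' (v ⊗ₜ h)) (v : V) :
    Λ (δ.coact v) = Λ' (δ.coact v) := by
  have e₁ : Λ = T ∘ₗ (TensorProduct.assoc k V H H).toLinearMap ∘ₗ LinearMap.rTensor H δ.coact :=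
    TensorProduct.ext' fun v h => by simp [h₁]
  have e₂ : Λ' = T ∘ₗ LinearMap.lTensor V Coalgebra.comul :=
    TensorProduct.ext' fun v h => by simp [h₂]
  rw [e₁, e₂]
  simp [δ.coassoc]

/-- This is the form used with antipode identities: after coassociativity the two `H`-legs cancel to
a counit, and the counit axiom of the comodule removes it. -/
theorem RightComodule.transfer_counit (δ : RightComodule k H V)
    (T : V ⊗[k] (H ⊗[k] H) →ₗ[k] M) {Λ : V ⊗[k] H →ₗ[k] M} {g : V →ₗ[k] M}
    (h₁ : ∀ v h, Λ (v ⊗ₜ h) = T (TensorProduct.assoc k V H H (δ.coact v ⊗ₜ h)))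
    (h₂ : ∀ v h, T (v ⊗ₜ Coalgebra.comul h) = (Coalgebra.counit h : k) • g v) (v : V) :
    Λ (δ.coact v) = g v := by
  rw [δ.transfer T (Λ' := g ∘ₗ (TensorProduct.rid k V).toLinearMap ∘ₗ
      LinearMap.lTensor V (Coalgebra.counit (R := k) (A := H))) h₁ fun v h => by simp [h₂]]
  simp [δ.counit_coact]

variable (k H) in
/-- The comodule algebra `H`, with its comultiplication as coaction. -/
def regularCoaction : Coaction k H H where
  coact := Coalgebra.comul
  coassoc := Coalgebra.coassoc_apply
  counit_coact v := by simp
  coact_mul := Bialgebra.comul_mul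

/-- The left handed version of `RightComodule.transfer` for `H` itself. -/
theorem comul_transfer (T : (H ⊗[k] H) ⊗[k] H →ₗ[k] M) {Λ Λ' : H ⊗[k] H →ₗ[k] M}
    (h₁ : ∀ x y, Λ (x ⊗ₜ y) = T ((TensorProduct.assoc k H H H).symm (x ⊗ₜ Coalgebra.comul y)))
    (h₂ : ∀ x y, T (Coalgebra.comul x ⊗ₜ y) = Λ' (x ⊗ₜ y)) (x : H) :
    Λ (Coalgebra.comul x) = Λ' (Coalgebra.comul x) := by
  have e₁ : Λ = T ∘ₗ (TensorProduct.assoc k H H H).symm.toLinearMap ∘ₗ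
      LinearMap.lTensor H Coalgebra.comul := TensorProduct.ext' fun v h => by simp [h₁]
  have e₂ : Λ' = T ∘ₗ LinearMap.rTensor H Coalgebra.comul :=
    TensorProduct.ext' fun v h => by simp [h₂]
  rw [e₁, e₂]
  simp

theorem comul_transfer_counit (T : (H ⊗[k] H) ⊗[k] H →ₗ[k] M) {Λ : H ⊗[k] H →ₗ[k] M}
    {g : H →ₗ[k] M}
    (h₁ : ∀ x y, Λ (x ⊗ₜ y) = T ((TensorProduct.assoc k H H H).symm (x ⊗ₜ Coalgebra.comul y)))
    (h₂ : ∀ x y, T (Coalgebra.comul x ⊗ₜ y) = (Coalgebra.counit x : k) • g y) (x : H) :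
    Λ (Coalgebra.comul x) = g x := by
  rw [comul_transfer T (Λ' := g ∘ₗ (TensorProduct.lid k H).toLinearMap ∘ₗ
      LinearMap.rTensor H (Coalgebra.counit (R := k) (A := H))) h₁ fun v h => by simp [h₂]]
  simp

end Sweedler

/-! ### Strong invariance, faithfulness of `φ`, surjectivity of the antipode. -/

section AntipodeBijective
variable {k : Type u} {H : Type v} [Field k] [Ring H] [HopfAlgebra k H]
variable (F : InvariantFunctionals k H)

/-- `x₍₁₎ φ(g x₍₂₎) = S(g₍₁₎) φ(g₍₂₎ x)` -/
theorem strong_left_invariance (g x : H) :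
    sliceRight (shift F.φ g) (Coalgebra.comul x) =
      HopfAlgebra.antipode k (sliceRight (rshift x F.φ) (Coalgebra.comul g)) := by
  -- Paired with `ω`, both sides are values at `x` of the functional `ω * φ(g -)`, which
  -- `convol_shift_phi` computes.
  refine eq_of_forall_dual (k := k) fun ω => ?_
  have h := LinearMap.congr_fun (convol_shift_phi F ω g) x
  rw [convol_apply, shift_apply] at h
  refine Eq.trans ?_ (h.trans ?_)
  · induction Coalgebra.comul (R := k) x with
    | zero => simp
    | add a b ha hb => simp only [map_add, ha, hb]
    | tmul a b => simp [mul_comm]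
  · induction Coalgebra.comul (R := k) g with
    | zero => simp
    | add a b ha hb => simp only [map_add, add_mul, ha, hb]
    | tmul a b => simp [mul_comm]

/-- `ψ(x₍₁₎ c) x₍₂₎ = ψ(x c₍₁₎) S(c₍₂₎)` -/
theorem strong_right_invariance (c x : H) :
    sliceLeft (rshift c F.ψ) (Coalgebra.comul x) =
      HopfAlgebra.antipode k (sliceLeft (shift F.ψ x) (Coalgebra.comul c)) := by
  refine eq_of_forall_dual (k := k) fun ω => ?_
  have h := LinearMap.congr_fun (convol_rshift_psi F ω c) x
  rw [convol_apply, rshift_apply] at h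
  refine Eq.trans ?_ (h.trans ?_)
  · induction Coalgebra.comul (R := k) x with
    | zero => simp
    | add a b ha hb => simp only [map_add, ha, hb]
    | tmul a b => simp
  · induction Coalgebra.comul (R := k) c with
    | zero => simp
    | add a b ha hb => simp only [map_add, mul_add, ha, hb]
    | tmul a b => simp [mul_comm]

/-- `φ(g x) = 0` for all `g` implies `x = 0`. -/
theorem phi_faithful {x : H} (hx : ∀ g, F.φ (g * x) = 0) : x = 0 := by
  obtain ⟨y, hy⟩ := exists_map_eq_one F.φ_ne_zero
  let S : H →ₗ[k] H := HopfAlgebra.antipode k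
  -- `Λ (Δ x) = x₍₁₎ φ(y S(x₍₂₎) x₍₃₎)` is evaluated twice. The antipode axiom and `φ(y) = 1` give
  -- `x`. On the other hand every slice `x₍₁₎ φ(g x₍₂₎)` vanishes by strong invariance, and `Λ` only
  -- sees its last leg through the functionals `φ(g -)`, so the value is `0`.
  let T : H ⊗[k] (H ⊗[k] H) →ₗ[k] H := sliceRight
    (F.φ ∘ₗ LinearMap.mulLeft k y ∘ₗ LinearMap.mul' k H ∘ₗ LinearMap.rTensor H S)
  let Λ : H ⊗[k] H →ₗ[k] H :=
    T ∘ₗ (TensorProduct.assoc k H H H).toLinearMap ∘ₗ LinearMap.rTensor H Coalgebra.comul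
  have h0 : Λ (Coalgebra.comul x) = 0 := by
    refine map_eq_zero_of_slices (fun g => shift F.φ g) (fun g => ?_) Λ fun p q hq => ?_
    · have : rshift x F.φ = 0 := LinearMap.ext fun g => by simp [hx]
      rw [strong_left_invariance, this]
      simp [sliceRight]
    · simp only [Λ, LinearMap.comp_apply, LinearMap.rTensor_tmul, LinearEquiv.coe_coe]
      induction Coalgebra.comul (R := k) p with
      | zero => simp
      | add a b ha hb => simp only [map_add, TensorProduct.add_tmul, ha, hb, add_zero]
      | tmul a b =>
        have := hq (y * S b)
        rw [shift_apply] at this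
        simp [T, ← mul_assoc, this]
  have h1 : Λ (Coalgebra.comul x) = (LinearMap.id : H →ₗ[k] H) x := by
    refine (regularCoaction k H).toRightComodule.transfer_counit T (fun v h => rfl)
      (fun v h => ?_) x
    simp [T, S, HopfAlgebra.mul_antipode_rTensor_comul_apply, Algebra.algebraMap_eq_smul_one, hy]
  rw [← h0, h1, LinearMap.id_apply]

/-- Expand `x = x₍₁₎ ψ(x₍₂₎ S(x₍₃₎) y)` with `ψ(y) = 1`. Each functional `ψ(- S(q) y)` equals some
`φ(g -)`, and strong left invariance puts `p₍₁₎ φ(g p₍₂₎)` in the range of `S`. -/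
theorem antipode_surjective (F : InvariantFunctionals k H) :
    Function.Surjective (HopfAlgebra.antipode k (A := H)) := by
  intro x
  obtain ⟨y, hy⟩ := exists_map_eq_one F.ψ_ne_zero
  let S : H →ₗ[k] H := HopfAlgebra.antipode k
  let T : H ⊗[k] (H ⊗[k] H) →ₗ[k] H := sliceRight
    (F.ψ ∘ₗ LinearMap.mulRight k y ∘ₗ LinearMap.mul' k H ∘ₗ LinearMap.lTensor H S)
  let Λ : H ⊗[k] H →ₗ[k] H :=
    T ∘ₗ (TensorProduct.assoc k H H H).toLinearMap ∘ₗ LinearMap.rTensor H Coalgebra.comul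
  have h0 : ∀ t : H ⊗[k] H, Λ t ∈ LinearMap.range S := by
    intro t
    induction t with
    | zero => simp
    | add a b ha hb => simpa only [map_add] using add_mem ha hb
    | tmul p q =>
      obtain ⟨g, hg⟩ := rshift_mem_dualHat F (S q * y)
      refine ⟨_, (strong_left_invariance F g p).symm.trans ?_⟩
      rw [hg]
      simp only [Λ, LinearMap.comp_apply, LinearMap.rTensor_tmul, LinearEquiv.coe_coe]
      induction Coalgebra.comul (R := k) p with
      | zero => simp
      | add a b ha hb => simp only [map_add, TensorProduct.add_tmul, ha, hb]
      | tmul a b => simp [T, mul_assoc]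
  have h1 : Λ (Coalgebra.comul x) = (LinearMap.id : H →ₗ[k] H) x := by
    refine (regularCoaction k H).toRightComodule.transfer_counit T (fun v h => rfl)
      (fun v h => ?_) x
    simp [T, S, HopfAlgebra.mul_antipode_lTensor_comul_apply, Algebra.algebraMap_eq_smul_one, hy]
  have h2 := h0 (Coalgebra.comul x)
  rw [h1] at h2
  exact h2

end AntipodeBijective

/-! ### Injectivity of the antipode, its inverse, and the isomorphism of `H` with `Ĥ`. -/

section AntipodeInverse
variable {k : Type u} {H : Type v} [Field k] [Ring H] [HopfAlgebra k H]

/-- If `S(z) = 0`, then `g ↦ φ(g S(z₍₁₎)) z₍₂₎` is killed by left convolution with `S`, hence is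
zero, as `S` is convolution invertible. Faithfulness of `φ` then allows `φ(g -)` to be replaced by
the counit, leaving `z = 0`. -/
theorem antipode_injective (F : InvariantFunctionals k H) :
    Function.Injective (HopfAlgebra.antipode k (A := H)) := by
  refine (injective_iff_map_eq_zero _).2 fun z hz => ?_
  let S : H →ₗ[k] H := HopfAlgebra.antipode k
  -- `G (p ⊗ q) g = φ(g S(p)) q`
  let G (t : H ⊗[k] H) : H →ₗ[k] H :=
    { toFun := fun g => sliceLeft (shift F.φ g ∘ₗ S) t
      map_add' := fun g g' => by simp [sliceLeft, LinearMap.add_comp, LinearMap.rTensor_add]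
      map_smul' := fun c g => by simp [sliceLeft, LinearMap.smul_comp, LinearMap.rTensor_smul] }
  have hG : ∀ t g, G t g = sliceLeft (shift F.φ g ∘ₗ S) t := fun t g => rfl
  have hSG : ∀ g, LinearMap.mul' k H (TensorProduct.map S (G (Coalgebra.comul z))
      (Coalgebra.comul g)) = 0 := by
    intro g
    -- By strong left invariance at `S(a)`, and since `S` reverses the comultiplication, `S(g₍₁₎)
    -- φ(g₍₂₎ S(a)) = φ(g S(a₍₁₎)) S(a₍₂₎)`. The expression to be killed is therefore `φ(g S(z₍₁₎))
    -- S(z₍₂₎) z₍₃₎ = φ(g S(z)) 1 = 0`.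
    let T : H ⊗[k] (H ⊗[k] H) →ₗ[k] H :=
      sliceLeft (shift F.φ g ∘ₗ S) ∘ₗ LinearMap.lTensor H (LinearMap.mul' k H ∘ₗ
        LinearMap.rTensor H S)
    let Λ : H ⊗[k] H →ₗ[k] H :=
      T ∘ₗ (TensorProduct.assoc k H H H).toLinearMap ∘ₗ LinearMap.rTensor H Coalgebra.comul
    have h1 : Λ (Coalgebra.comul z) = 0 := by
      refine ((regularCoaction k H).toRightComodule.transfer_counit T (Λ := Λ)
        (g := LinearMap.toSpanSingleton k H 1 ∘ₗ shift F.φ g ∘ₗ S)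
        (fun v h => rfl) (fun v h => ?_) z).trans ?_
      · simp only [T, S, LinearMap.comp_apply, LinearMap.lTensor_tmul,
          HopfAlgebra.mul_antipode_rTensor_comul_apply, Algebra.algebraMap_eq_smul_one,
          sliceLeft_tmul, LinearMap.toSpanSingleton_apply]
        rw [smul_comm]
      · simp [S, hz]
    have h3 : ∀ a w : H, Λ (a ⊗ₜ w) =
        S (sliceRight (rshift (S a) F.φ) (Coalgebra.comul g)) * w := by
      intro a w
      rw [← strong_left_invariance]
      simp only [S]
      rw [comul_antipode]
      simp only [Λ, LinearMap.comp_apply, LinearMap.rTensor_tmul, LinearEquiv.coe_coe]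
      induction Coalgebra.comul (R := k) a with
      | zero => simp
      | add a b ha hb => simp only [map_add, TensorProduct.add_tmul, add_mul, ha, hb]
      | tmul a b => simp [T, S]
    rw [← h1]
    induction Coalgebra.comul (R := k) z with
    | zero =>
      have h0 : G 0 = 0 := LinearMap.ext fun g => by simp [hG]
      simp [h0]
    | add a b ha hb =>
      have h0 : G (a + b) = G a + G b := LinearMap.ext fun g => by simp [hG]
      rw [h0, TensorProduct.map_add_right, LinearMap.add_apply, map_add, map_add, ha, hb]
    | tmul a w =>
      rw [h3]
      induction Coalgebra.comul (R := k) g with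
      | zero => simp
      | add p q hp hq => simp only [map_add, add_mul, hp, hq]
      | tmul p q => simp [hG]
  have hG0 : G (Coalgebra.comul z) = 0 := by
    -- In the convolution algebra `id * S = 1`, so `S * G = 0` gives `G = id * (S * G) = 0`.
    have h1 : WithConv.toConv S * WithConv.toConv (G (Coalgebra.comul z)) = 0 :=
      WithConv.ext (LinearMap.ext fun g => hSG g)
    have h2 : WithConv.toConv (G (Coalgebra.comul z)) = 0 := by
      rw [← one_mul (WithConv.toConv (G (Coalgebra.comul z))), ← LinearMap.id_mul_antipode,
        mul_assoc, h1, mul_zero]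
    exact congrArg WithConv.ofConv h2
  -- The tensor `z₍₂₎ ⊗ S(z₍₁₎)` has vanishing slices under all `φ(g -)`, which by faithfulness have
  -- no common kernel. Slicing by the counit then gives `ε(S(z₍₁₎)) z₍₂₎ = z`.
  have h := map_eq_zero_of_slices (M := H) (fun g => shift F.φ g)
    (t := TensorProduct.comm k H H (LinearMap.rTensor H S (Coalgebra.comul z))) (fun g => ?_)
    (sliceRight (Coalgebra.counit (R := k))) (fun v w hw => ?_)
  · have e : ∀ t : H ⊗[k] H, sliceRight (Coalgebra.counit (R := k))
        (TensorProduct.comm k H H (LinearMap.rTensor H S t)) =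
        TensorProduct.lid k H (LinearMap.rTensor H Coalgebra.counit t) := by
      intro t
      induction t with
      | zero => simp
      | add a b ha hb => simp only [map_add, ha, hb]
      | tmul a b => simp [S]
    rw [e] at h
    simpa using h
  · have h := LinearMap.congr_fun hG0 g
    rw [hG] at h
    refine Eq.trans ?_ h
    induction Coalgebra.comul (R := k) z with
    | zero => simp
    | add a b ha hb => simp only [map_add, ha, hb]
    | tmul a b => simp
  · simp [phi_faithful F hw]

/-- The antipode as a linear automorphism. -/
def antipodeEquiv (F : InvariantFunctionals k H) : H ≃ₗ[k] H :=
  LinearEquiv.ofBijective (HopfAlgebra.antipode k)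
    ⟨antipode_injective F, antipode_surjective F⟩

/-- The inverse of the antipode. -/
def antipodeInv (F : InvariantFunctionals k H) : H →ₗ[k] H := (antipodeEquiv F).symm.toLinearMap

variable (F : InvariantFunctionals k H)

@[simp] theorem antipode_antipodeInv (x : H) :
    HopfAlgebra.antipode k (antipodeInv F x) = x := (antipodeEquiv F).apply_symm_apply x

@[simp] theorem antipodeInv_antipode (x : H) :
    antipodeInv F (HopfAlgebra.antipode k x) = x := (antipodeEquiv F).symm_apply_apply x

theorem antipodeInv_mul (x y : H) :
    antipodeInv F (x * y) = antipodeInv F y * antipodeInv F x := by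
  refine antipode_injective F ?_
  simp [HopfAlgebra.antipode_mul_antidistrib]

@[simp] theorem antipodeInv_one : antipodeInv F (1 : H) = 1 :=
  antipode_injective F (by simp)

theorem comul_antipodeInv (x : H) : Coalgebra.comul (antipodeInv F x) =
    TensorProduct.map (antipodeInv F) (antipodeInv F)
      (TensorProduct.comm k H H (Coalgebra.comul x)) := by
  have h := comul_antipode (k := k) (antipodeInv F x)
  rw [antipode_antipodeInv] at h
  rw [h]
  induction Coalgebra.comul (R := k) (antipodeInv F x) with
  | zero => simp
  | add a b ha hb => simp only [map_add, ← ha, ← hb]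
  | tmul a b => simp

/-- `S⁻¹(x₍₂₎) x₍₁₎ = ε(x)` -/
theorem antipodeInv_mul_comm_comul (x : H) : LinearMap.mul' k H
    (LinearMap.rTensor H (antipodeInv F) (TensorProduct.comm k H H (Coalgebra.comul x))) =
      (Coalgebra.counit x : k) • (1 : H) := by
  -- `S` reverses products, so applying it turns the claim into `S(x₍₁₎) x₍₂₎ = ε(x)`.
  refine antipode_injective F ?_
  have e : ∀ t : H ⊗[k] H, HopfAlgebra.antipode k (LinearMap.mul' k H
    (LinearMap.rTensor H (antipodeInv F) (TensorProduct.comm k H H t))) =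
      LinearMap.mul' k H (LinearMap.rTensor H (HopfAlgebra.antipode k) t) := by
    intro t
    induction t with
    | zero => simp
    | add a b ha hb => simp only [map_add, ha, hb]
    | tmul a b => simp [HopfAlgebra.antipode_mul_antidistrib]
  rw [e, HopfAlgebra.mul_antipode_rTensor_comul_apply]
  simp [Algebra.algebraMap_eq_smul_one]

/-- `x₍₂₎ S⁻¹(x₍₁₎) = ε(x)` -/
theorem mul_antipodeInv_comm_comul (x : H) : LinearMap.mul' k H
    (LinearMap.lTensor H (antipodeInv F) (TensorProduct.comm k H H (Coalgebra.comul x))) =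
      (Coalgebra.counit x : k) • (1 : H) := by
  refine antipode_injective F ?_
  have e : ∀ t : H ⊗[k] H, HopfAlgebra.antipode k (LinearMap.mul' k H
    (LinearMap.lTensor H (antipodeInv F) (TensorProduct.comm k H H t))) =
      LinearMap.mul' k H (LinearMap.lTensor H (HopfAlgebra.antipode k) t) := by
    intro t
    induction t with
    | zero => simp
    | add a b ha hb => simp only [map_add, ha, hb]
    | tmul a b => simp [HopfAlgebra.antipode_mul_antidistrib]
  rw [e, HopfAlgebra.mul_antipode_lTensor_comul_apply]
  simp [Algebra.algebraMap_eq_smul_one]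

/-- The linear map underlying `S⁻²`. -/
def antipodeInvSq : H →ₗ[k] H := antipodeInv F ∘ₗ antipodeInv F

theorem antipodeInvSq_apply (x : H) :
    antipodeInvSq F x = antipodeInv F (antipodeInv F x) := rfl

theorem antipodeInvSq_mul (x y : H) :
    antipodeInvSq F (x * y) = antipodeInvSq F x * antipodeInvSq F y := by
  simp [antipodeInvSq_apply, antipodeInv_mul]

theorem comul_antipodeInvSq (x : H) : Coalgebra.comul (antipodeInvSq F x) =
    TensorProduct.map (antipodeInvSq F) (antipodeInvSq F) (Coalgebra.comul x) := by
  rw [antipodeInvSq_apply, comul_antipodeInv, comul_antipodeInv]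
  induction Coalgebra.comul (R := k) x with
  | zero => simp
  | add a b ha hb => simp only [map_add, ha, hb]
  | tmul a b => simp [antipodeInvSq_apply]

/-- `S⁻¹(x₍₁₎) S⁻²(x₍₂₎) = ε(x)` -/
theorem antipodeInv_mul_antipodeInvSq (x : H) : LinearMap.mul' k H
    (TensorProduct.map (antipodeInv F) (antipodeInvSq F) (Coalgebra.comul x)) =
      (Coalgebra.counit x : k) • (1 : H) := by
  have h := congrArg (antipodeInv F) (antipodeInv_mul_comm_comul F x)
  rw [map_smul, antipodeInv_one] at h
  rw [← h]
  induction Coalgebra.comul (R := k) x with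
  | zero => simp
  | add a b ha hb => simp only [map_add, ha, hb]
  | tmul a b => simp [antipodeInvSq_apply, antipodeInv_mul]

/-- `S⁻²(x₍₁₎) S⁻¹(x₍₂₎) = ε(x)` -/
theorem antipodeInvSq_mul_antipodeInv (x : H) : LinearMap.mul' k H
    (TensorProduct.map (antipodeInvSq F) (antipodeInv F) (Coalgebra.comul x)) =
      (Coalgebra.counit x : k) • (1 : H) := by
  have h := congrArg (antipodeInv F) (mul_antipodeInv_comm_comul F x)
  rw [map_smul, antipodeInv_one] at h
  rw [← h]
  induction Coalgebra.comul (R := k) x with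
  | zero => simp
  | add a b ha hb => simp only [map_add, ha, hb]
  | tmul a b => simp [antipodeInvSq_apply, antipodeInv_mul]

/-- `ψ(x c) = 0` for all `x` implies `c = 0`. -/
theorem psi_faithful {c : H} (hc : ∀ x, F.ψ (x * c) = 0) : c = 0 := by
  obtain ⟨y, hy⟩ := exists_map_eq_one F.ψ_ne_zero
  -- `T ((p ⊗ q) ⊗ r) = ψ(y S⁻¹(q) p) r`
  let T : (H ⊗[k] H) ⊗[k] H →ₗ[k] H := sliceLeft (F.ψ ∘ₗ LinearMap.mulLeft k y ∘ₗ
    LinearMap.mul' k H ∘ₗ LinearMap.rTensor H (antipodeInv F) ∘ₗ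
      (TensorProduct.comm k H H).toLinearMap)
  let Λ : H ⊗[k] H →ₗ[k] H :=
    T ∘ₗ (TensorProduct.assoc k H H H).symm.toLinearMap ∘ₗ LinearMap.lTensor H Coalgebra.comul
  -- `Λ (Δ c) = ψ(y S⁻¹(c₍₂₎) c₍₁₎) c₍₃₎` equals `c`. It also vanishes: strong right invariance
  -- gives `S(ψ(x c₍₁₎) c₍₂₎) = 0`, and injectivity of `S` makes the slices `ψ(x c₍₁₎) c₍₂₎` zero.
  -- The legs are flipped so that the slicing is on the right.
  have h0 : (Λ ∘ₗ (TensorProduct.comm k H H).toLinearMap)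
      (TensorProduct.comm k H H (Coalgebra.comul c)) = 0 := by
    refine map_eq_zero_of_slices (fun x => shift F.ψ x) (fun x => ?_) _ fun p q hq => ?_
    · have h1 : rshift c F.ψ = 0 := LinearMap.ext fun x => by simp [hc]
      have h2 := strong_right_invariance F c x
      rw [h1] at h2
      refine Eq.trans ?_ (antipode_injective F ((h2.symm.trans ?_).trans (map_zero _).symm))
      · induction Coalgebra.comul (R := k) c with
        | zero => simp
        | add a b ha hb => simp only [map_add, ha, hb]
        | tmul a b => simp
      · simp [sliceLeft]
    · simp only [Λ, LinearMap.comp_apply, LinearEquiv.coe_coe, TensorProduct.comm_tmul,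
        LinearMap.lTensor_tmul]
      induction Coalgebra.comul (R := k) p with
      | zero => simp
      | add a b ha hb => simp only [map_add, TensorProduct.tmul_add, ha, hb, add_zero]
      | tmul a b =>
        have := hq (y * antipodeInv F a)
        rw [shift_apply] at this
        simp [T, ← mul_assoc, this]
  have h1 : Λ (Coalgebra.comul c) = (LinearMap.id : H →ₗ[k] H) c := by
    refine comul_transfer_counit T (fun v h => rfl) (fun v h => ?_) c
    simp only [T, sliceLeft_tmul, LinearMap.comp_apply, LinearEquiv.coe_coe]
    rw [antipodeInv_mul_comm_comul]
    simp [hy]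
  rw [LinearMap.comp_apply, LinearEquiv.coe_coe, TensorProduct.comm_comm, h1] at h0
  exact h0

/-- The isomorphism `H → Ĥ`, `c ↦ ψ(- c)`. -/
def psiEquiv : H ≃ₗ[k] dualHat F :=
  LinearEquiv.ofBijective
    ((rshift.flip F.ψ).codRestrict (dualHat F) (rshift_mem_dualHat F)) <| by
    constructor
    · refine (injective_iff_map_eq_zero _).2 fun c hc => psi_faithful F fun x => ?_
      exact LinearMap.congr_fun (congrArg Subtype.val hc) x
    · rintro ⟨_, a, rfl⟩
      obtain ⟨c, hc⟩ := exists_rshift_eq_shift F a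
      exact ⟨c, Subtype.ext hc⟩

@[simp] theorem psiEquiv_apply (c x : H) : (psiEquiv F c).1 x = F.ψ (x * c) := rfl

end AntipodeInverse

/-! ### Tensor products and transport of comodules. -/

section TensorComodule
variable {k : Type u} {H : Type v} [Field k] [Ring H] [HopfAlgebra k H]
variable {V : Type*} [AddCommGroup V] [Module k V] {W : Type*} [AddCommGroup W] [Module k W]

namespace RightComodule

/-- The tensor product of two comodules, with coaction
`v ⊗ w ↦ (v₍₀₎ ⊗ w₍₀₎) ⊗ v₍₁₎ w₍₁₎`. -/
def tensor (δ : RightComodule k H V) (γ : RightComodule k H W) :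
    RightComodule k H (V ⊗[k] W) where
  coact := TensorProduct.lift
    ((TensorProduct.map₂ (TensorProduct.mk k V W) (LinearMap.mul k H)).compl₁₂ δ.coact γ.coact)
  coassoc x := by
    induction x with
    | zero => simp
    | add x y hx hy => simp only [map_add, hx, hy]
    | tmul v w =>
      have h1 : ∀ s t, TensorProduct.assoc k (V ⊗[k] W) H H (LinearMap.rTensor H (TensorProduct.lift
          ((TensorProduct.map₂ (TensorProduct.mk k V W) (LinearMap.mul k H)).compl₁₂
            δ.coact γ.coact))
          (TensorProduct.map₂ (TensorProduct.mk k V W) (LinearMap.mul k H) s t)) =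
          TensorProduct.map₂ (TensorProduct.mk k V W) (LinearMap.mul k (H ⊗[k] H))
            (TensorProduct.assoc k V H H (LinearMap.rTensor H δ.coact s))
            (TensorProduct.assoc k W H H (LinearMap.rTensor H γ.coact t)) := by
        intro s t
        induction s with
        | zero => simp
        | add x y hx hy => simp only [map_add, LinearMap.add_apply, hx, hy]
        | tmul v h =>
          induction t with
          | zero => simp
          | add x y hx hy => simp only [map_add, hx, hy]
          | tmul w l =>
            simp only [TensorProduct.map₂_apply_tmul, LinearMap.rTensor_tmul,
              TensorProduct.map_tmul, LinearMap.mul_apply', TensorProduct.mk_apply,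
              TensorProduct.lift.tmul, LinearMap.compl₁₂_apply]
            induction δ.coact v with
            | zero => simp
            | add x y hx hy =>
              simp only [map_add, LinearMap.add_apply, TensorProduct.add_tmul, hx, hy]
            | tmul v p =>
              induction γ.coact w with
              | zero => simp
              | add x y hx hy =>
                simp only [map_add, TensorProduct.add_tmul, hx, hy]
              | tmul w q => simp
      have h2 : ∀ s t, LinearMap.lTensor (V ⊗[k] W) Coalgebra.comul
          (TensorProduct.map₂ (TensorProduct.mk k V W) (LinearMap.mul k H) s t) =
          TensorProduct.map₂ (TensorProduct.mk k V W) (LinearMap.mul k (H ⊗[k] H))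
            (LinearMap.lTensor V Coalgebra.comul s) (LinearMap.lTensor W Coalgebra.comul t) := by
        intro s t
        induction s with
        | zero => simp
        | add x y hx hy => simp only [map_add, LinearMap.add_apply, hx, hy]
        | tmul v h =>
          induction t with
          | zero => simp
          | add x y hx hy => simp only [map_add, hx, hy]
          | tmul w l => simp
      rw [TensorProduct.lift.tmul, LinearMap.compl₁₂_apply, h1, h2, δ.coassoc, γ.coassoc]
  counit_coact x := by
    induction x with
    | zero => simp
    | add x y hx hy => simp only [map_add, hx, hy]
    | tmul v w =>
      have h1 : ∀ s t, TensorProduct.rid k (V ⊗[k] W)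
          (LinearMap.lTensor (V ⊗[k] W) (Coalgebra.counit (R := k) (A := H))
          (TensorProduct.map₂ (TensorProduct.mk k V W) (LinearMap.mul k H) s t)) =
          TensorProduct.rid k V (LinearMap.lTensor V Coalgebra.counit s) ⊗ₜ
            TensorProduct.rid k W (LinearMap.lTensor W Coalgebra.counit t) := by
        intro s t
        induction s with
        | zero => simp
        | add x y hx hy =>
          simp only [map_add, LinearMap.add_apply, TensorProduct.add_tmul, hx, hy]
        | tmul v h =>
          induction t with
          | zero => simp
          | add x y hx hy => simp only [map_add, TensorProduct.tmul_add, hx, hy]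
          | tmul w l => simp [TensorProduct.smul_tmul, smul_smul, mul_comm]
      rw [TensorProduct.lift.tmul, LinearMap.compl₁₂_apply, h1, δ.counit_coact, γ.counit_coact]

theorem tensor_coact_tmul (δ : RightComodule k H V) (γ : RightComodule k H W) (v : V) (w : W) :
    (δ.tensor γ).coact (v ⊗ₜ w) =
      TensorProduct.map₂ (TensorProduct.mk k V W) (LinearMap.mul k H) (δ.coact v) (γ.coact w) :=
  rfl

/-- Transport of a comodule structure along a linear isomorphism. -/
def congr (e : V ≃ₗ[k] W) (δ : RightComodule k H V) : RightComodule k H W where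
  coact := LinearMap.rTensor H e.toLinearMap ∘ₗ δ.coact ∘ₗ e.symm.toLinearMap
  coassoc w := by
    have h := congrArg (LinearMap.rTensor (H ⊗[k] H) e.toLinearMap) (δ.coassoc (e.symm w))
    refine Eq.trans ?_ (h.trans ?_)
    · simp only [LinearMap.comp_apply, LinearEquiv.coe_coe]
      induction δ.coact (e.symm w) with
      | zero => simp
      | add x y hx hy => simp only [map_add, hx, hy]
      | tmul v h =>
        simp only [LinearMap.rTensor_tmul, LinearMap.comp_apply, LinearEquiv.coe_coe,
          LinearEquiv.symm_apply_apply]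
        induction δ.coact v with
        | zero => simp
        | add x y hx hy => simp only [map_add, TensorProduct.add_tmul, hx, hy]
        | tmul v l => simp
    · simp only [LinearMap.comp_apply, LinearEquiv.coe_coe]
      induction δ.coact (e.symm w) with
      | zero => simp
      | add x y hx hy => simp only [map_add, hx, hy]
      | tmul v h => simp
  counit_coact w := by
    have h := congrArg e (δ.counit_coact (e.symm w))
    rw [LinearEquiv.apply_symm_apply] at h
    refine Eq.trans ?_ h
    simp only [LinearMap.comp_apply, LinearEquiv.coe_coe]
    induction δ.coact (e.symm w) with
    | zero => simp
    | add x y hx hy => simp only [map_add, hx, hy]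
    | tmul v h => simp

theorem congr_coact (e : V ≃ₗ[k] W) (δ : RightComodule k H V) (v : V) :
    (δ.congr e).coact (e v) = LinearMap.rTensor H e.toLinearMap (δ.coact v) := by
  simp [congr]

theorem tensor_coact_congr {V' W' : Type*} [AddCommGroup V'] [Module k V'] [AddCommGroup W']
    [Module k W'] {δ : RightComodule k H V} {γ : RightComodule k H W}
    {δ' : RightComodule k H V'} {γ' : RightComodule k H W'} {f : V →ₗ[k] V'} {g : W →ₗ[k] W'}
    (hf : ∀ v, δ'.coact (f v) = LinearMap.rTensor H f (δ.coact v))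
    (hg : ∀ w, γ'.coact (g w) = LinearMap.rTensor H g (γ.coact w)) (x : V ⊗[k] W) :
    (δ'.tensor γ').coact (TensorProduct.map f g x) =
      LinearMap.rTensor H (TensorProduct.map f g) ((δ.tensor γ).coact x) := by
  induction x with
  | zero => simp
  | add x y hx hy => simp only [map_add, hx, hy]
  | tmul v w =>
    rw [TensorProduct.map_tmul, tensor_coact_tmul, tensor_coact_tmul, hf, hg]
    induction δ.coact v with
    | zero => simp
    | add x y hx hy => simp only [map_add, LinearMap.add_apply, hx, hy]
    | tmul v h =>
      induction γ.coact w with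
      | zero => simp
      | add x y hx hy => simp only [map_add, hx, hy]
      | tmul w l => simp

variable (k H V) in
/-- The trivial comodule, `v ↦ v ⊗ 1`. -/
def trivial : RightComodule k H V where
  coact := (TensorProduct.mk k V H).flip 1
  coassoc v := by simp [Algebra.TensorProduct.one_def]
  counit_coact v := by simp

end RightComodule

end TensorComodule

/-! ### Rank-one matrices with coefficients in `A`. -/

section MatrixContext
variable {k : Type u} {H : Type v} [Field k] [Ring H] [HopfAlgebra k H]
variable {A : Type w} [NonUnitalRing A] [Module k A] [IsScalarTower k A A] [SMulCommClass k A A]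
variable {M₁ M₂ M₃ M₄ : Type*} [AddCommGroup M₁] [Module k M₁] [AddCommGroup M₂] [Module k M₂]
  [AddCommGroup M₃] [Module k M₃] [AddCommGroup M₄] [Module k M₄]

variable (A M₁ M₄) in
/-- The multiplication `((u ⊗ a) ⊗ w) ((u' ⊗ a') ⊗ w') = p(w, u') (u ⊗ a a') ⊗ w'`. -/
def rankOneMul (p : M₂ →ₗ[k] M₃ →ₗ[k] k) :
    (M₁ ⊗[k] A) ⊗[k] M₂ →ₗ[k] (M₃ ⊗[k] A) ⊗[k] M₄ →ₗ[k] (M₁ ⊗[k] A) ⊗[k] M₄ :=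
  TensorProduct.lift (LinearMap.mk₂ k
    (fun x w => LinearMap.rTensor M₄ (TensorProduct.lift
      ((LinearMap.lsmul k (M₁ ⊗[k] A)).compl₁₂ (p w)
        ((LinearMap.lTensorHom M₁ ∘ₗ (LinearMap.mul k A).flip).flip x))))
    (fun _ _ _ => by ext; simp [TensorProduct.add_tmul])
    (fun _ _ _ => by ext; simp [TensorProduct.smul_tmul', smul_smul])
    (fun _ _ _ => by ext; simp [TensorProduct.add_tmul])
    (fun _ _ _ => by ext; simp [TensorProduct.smul_tmul', mul_smul]))

@[simp] theorem rankOneMul_tmul (p : M₂ →ₗ[k] M₃ →ₗ[k] k) (u : M₁) (a : A) (w : M₂) (u' : M₃)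
    (a' : A) (w' : M₄) : rankOneMul A M₁ M₄ p ((u ⊗ₜ a) ⊗ₜ w) ((u' ⊗ₜ a') ⊗ₜ w') =
      p w u' • ((u ⊗ₜ (a * a')) ⊗ₜ w') := by
  simp [rankOneMul, TensorProduct.smul_tmul']

theorem rankOneMul_assoc {M₅ M₆ : Type*} [AddCommGroup M₅] [Module k M₅] [AddCommGroup M₆]
    [Module k M₆] (p : M₂ →ₗ[k] M₃ →ₗ[k] k) (q : M₄ →ₗ[k] M₅ →ₗ[k] k)
    (x : (M₁ ⊗[k] A) ⊗[k] M₂) (y : (M₃ ⊗[k] A) ⊗[k] M₄) (z : (M₅ ⊗[k] A) ⊗[k] M₆) :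
    rankOneMul A M₁ M₆ q (rankOneMul A M₁ M₄ p x y) z =
      rankOneMul A M₁ M₆ p x (rankOneMul A M₃ M₆ q y z) := by
  have h : (rankOneMul A M₁ M₄ p).compr₂ (rankOneMul A M₁ M₆ q) =
      (LinearMap.llcomp k _ _ _).compl₁₂ (rankOneMul A M₁ M₆ p) (rankOneMul A M₃ M₆ q) := by
    ext
    simp [mul_assoc, smul_smul, mul_comm]
  exact LinearMap.congr_fun (LinearMap.congr_fun₂ h x y) z

/-- The coaction of `(M₁ ⊗ A) ⊗ M₂` is multiplicative if the pairing is invariant. -/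
theorem coact_rankOneMul (δ₁ : RightComodule k H M₁) (δ₂ : RightComodule k H M₂)
    (δ₃ : RightComodule k H M₃) (δ₄ : RightComodule k H M₄) (α : Coaction k H A)
    (p : M₂ →ₗ[k] M₃ →ₗ[k] k)
    (hp : ∀ w u, TensorProduct.map₂ p (LinearMap.mul k H) (δ₂.coact w) (δ₃.coact u) = p w u ⊗ₜ 1)
    (x : (M₁ ⊗[k] A) ⊗[k] M₂) (y : (M₃ ⊗[k] A) ⊗[k] M₄) :
    ((δ₁.tensor α.toRightComodule).tensor δ₄).coact (rankOneMul A M₁ M₄ p x y) =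
      TensorProduct.map₂ (rankOneMul A M₁ M₄ p) (LinearMap.mul k H)
        (((δ₁.tensor α.toRightComodule).tensor δ₂).coact x)
        (((δ₃.tensor α.toRightComodule).tensor δ₄).coact y) := by
  have key : ∀ (s₁ : M₁ ⊗[k] H) (s t : A ⊗[k] H) (s₂ : M₂ ⊗[k] H) (t₃ : M₃ ⊗[k] H)
      (t₄ : M₄ ⊗[k] H) (c : k), TensorProduct.map₂ p (LinearMap.mul k H) s₂ t₃ = c ⊗ₜ 1 →
      c • TensorProduct.map₂ (TensorProduct.mk k (M₁ ⊗[k] A) M₄) (LinearMap.mul k H)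
        (TensorProduct.map₂ (TensorProduct.mk k M₁ A) (LinearMap.mul k H) s₁ (s * t)) t₄ =
      TensorProduct.map₂ (rankOneMul A M₁ M₄ p) (LinearMap.mul k H)
        (TensorProduct.map₂ (TensorProduct.mk k (M₁ ⊗[k] A) M₂) (LinearMap.mul k H)
          (TensorProduct.map₂ (TensorProduct.mk k M₁ A) (LinearMap.mul k H) s₁ s) s₂)
        (TensorProduct.map₂ (TensorProduct.mk k (M₃ ⊗[k] A) M₄) (LinearMap.mul k H)
          (TensorProduct.map₂ (TensorProduct.mk k M₃ A) (LinearMap.mul k H) t₃ t) t₄) := by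
    intro s₁ s t s₂ t₃ t₄ c hc
    induction s₁ with
    | zero => simp
    | add x y hx hy => simp only [map_add, LinearMap.add_apply, smul_add, hx, hy]
    | tmul u h₁ =>
      induction s with
      | zero => simp
      | add x y hx hy => simp only [map_add, add_mul, LinearMap.add_apply, smul_add, hx, hy]
      | tmul a h₂ =>
        induction t with
        | zero => simp
        | add x y hx hy => simp only [map_add, mul_add, LinearMap.add_apply, smul_add, hx, hy]
        | tmul a' h₃ =>
          induction t₄ with
          | zero => simp
          | add x y hx hy => simp only [map_add, smul_add, hx, hy]
          | tmul w' h₄ =>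
            -- In the product of the two coactions the `H`-legs of the contracted vectors stand next
            -- to each other, as `h₁ h₂ (w₍₁₎ u'₍₁₎) h₃ h₄`. Invariance of `p` replaces the bracket
            -- by `1` without commuting anything; `G` restores the surrounding factors.
            let G : k ⊗[k] H →ₗ[k] ((M₁ ⊗[k] A) ⊗[k] M₄) ⊗[k] H :=
              TensorProduct.map (LinearMap.toSpanSingleton k _ ((u ⊗ₜ (a * a')) ⊗ₜ w'))
                (LinearMap.mulLeft k (h₁ * h₂) ∘ₗ LinearMap.mulRight k (h₃ * h₄))
            have hG : ∀ (s₂ : M₂ ⊗[k] H) (t₃ : M₃ ⊗[k] H),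
                G (TensorProduct.map₂ p (LinearMap.mul k H) s₂ t₃) =
                TensorProduct.map₂ (rankOneMul A M₁ M₄ p) (LinearMap.mul k H)
                (TensorProduct.map₂ (TensorProduct.mk k (M₁ ⊗[k] A) M₂) (LinearMap.mul k H)
                  (TensorProduct.map₂ (TensorProduct.mk k M₁ A) (LinearMap.mul k H)
                    (u ⊗ₜ h₁) (a ⊗ₜ h₂)) s₂)
                (TensorProduct.map₂ (TensorProduct.mk k (M₃ ⊗[k] A) M₄) (LinearMap.mul k H)
                  (TensorProduct.map₂ (TensorProduct.mk k M₃ A) (LinearMap.mul k H)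
                    t₃ (a' ⊗ₜ h₃)) (w' ⊗ₜ h₄)) := by
              intro s₂ t₃
              induction s₂ with
              | zero => simp
              | add x y hx hy => simp only [map_add, LinearMap.add_apply, hx, hy]
              | tmul w l =>
                induction t₃ with
                | zero => simp
                | add x y hx hy => simp only [map_add, LinearMap.add_apply, hx, hy]
                | tmul u' l' => simp [G, mul_assoc]
            rw [← hG, hc]
            simp [G, TensorProduct.smul_tmul', mul_assoc]
  induction x with
  | zero => simp
  | add x y hx hy => simp only [map_add, LinearMap.add_apply, hx, hy]
  | tmul v w =>
    induction v with
    | zero => simp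
    | add x y hx hy => simp only [TensorProduct.add_tmul, map_add, LinearMap.add_apply, hx, hy]
    | tmul u a =>
      induction y with
      | zero => simp
      | add x y hx hy => simp only [map_add, hx, hy]
      | tmul v' w' =>
        induction v' with
        | zero => simp
        | add x y hx hy => simp only [TensorProduct.add_tmul, map_add, hx, hy]
        | tmul u' a' =>
          simp only [rankOneMul_tmul, map_smul, RightComodule.tensor_coact_tmul, α.coact_mul]
          exact key _ _ _ _ _ _ _ (hp w u')

end MatrixContext

/-! ### Invariant pairings and strictness of the associated Morita context. -/

section RankOneContext

/-- An `H`-comodule with an invariant bilinear form `p(w₍₀₎, u₍₀₎) w₍₁₎ u₍₁₎ = p(w, u) 1`, which is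
not zero. -/
structure InvariantPairing (k : Type u) (H : Type v) [Field k] [Ring H] [HopfAlgebra k H] where
  carrier : Type w
  [addCommGroup : AddCommGroup carrier]
  [module : Module k carrier]
  comodule : RightComodule k H carrier
  pairing : carrier →ₗ[k] carrier →ₗ[k] k
  invariant : ∀ x y, TensorProduct.map₂ pairing (LinearMap.mul k H) (comodule.coact x)
    (comodule.coact y) = pairing x y ⊗ₜ 1
  exists_pairing_eq_one : ∃ x y, pairing x y = 1

namespace InvariantPairing
variable {k : Type u} {H : Type v} [Field k] [Ring H] [HopfAlgebra k H]

instance (P : InvariantPairing.{u, v, w} k H) : AddCommGroup P.carrier := P.addCommGroup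
instance (P : InvariantPairing.{u, v, w} k H) : Module k P.carrier := P.module

/-- Transport of an invariant pairing along a linear isomorphism. -/
def congr (P : InvariantPairing.{u, v, w} k H) {M : Type w'} [AddCommGroup M] [Module k M]
    (e : P.carrier ≃ₗ[k] M) : InvariantPairing.{u, v, w'} k H where
  carrier := M
  comodule := P.comodule.congr e
  pairing := P.pairing.compl₁₂ e.symm.toLinearMap e.symm.toLinearMap
  invariant x y := by
    obtain ⟨x, rfl⟩ := e.surjective x
    obtain ⟨y, rfl⟩ := e.surjective y
    rw [P.comodule.congr_coact, P.comodule.congr_coact]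
    have h : ∀ s t, TensorProduct.map₂ (P.pairing.compl₁₂ e.symm.toLinearMap e.symm.toLinearMap)
        (LinearMap.mul k H) (LinearMap.rTensor H e.toLinearMap s)
        (LinearMap.rTensor H e.toLinearMap t) =
        TensorProduct.map₂ P.pairing (LinearMap.mul k H) s t := by
      intro s t
      induction s with
      | zero => simp
      | add x y hx hy => simp only [map_add, LinearMap.add_apply, hx, hy]
      | tmul a h =>
        induction t with
        | zero => simp
        | add x y hx hy => simp only [map_add, hx, hy]
        | tmul b l => simp
    rw [h, P.invariant]
    simp
  exists_pairing_eq_one := by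
    obtain ⟨x, y, h⟩ := P.exists_pairing_eq_one
    exact ⟨e x, e y, by simpa using h⟩

variable (k H) in
/-- The trivial comodule `k`, with its multiplication as pairing. -/
def unit : InvariantPairing.{u, v, u} k H where
  carrier := k
  comodule := .trivial k H k
  pairing := LinearMap.mul k k
  invariant x y := by simp [RightComodule.trivial]
  exists_pairing_eq_one := ⟨1, 1, by simp⟩

/-- `H` with the coaction `c ↦ c₍₁₎ ⊗ S²(c₍₂₎)` and the pairing `(h, c) ↦ ψ(h c)`. -/
def ofPsi (F : InvariantFunctionals k H) : InvariantPairing.{u, v, v} k H where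
  carrier := H
  comodule := ((regularCoaction k H).twist (antipodeSq k H)).toRightComodule
  pairing := (LinearMap.mul k H).compr₂ F.ψ
  invariant x y := by
    change TensorProduct.map₂ _ _ (LinearMap.lTensor H (antipodeSq k H : H →ₗ[k] H)
      (Coalgebra.comul x)) (LinearMap.lTensor H (antipodeSq k H : H →ₗ[k] H)
      (Coalgebra.comul y)) = _
    -- Multiplicativity of `S²` and of the comultiplication turns the left side into `S²` applied to
    -- `(ψ ⊗ id) Δ(x y)`, which right invariance makes the scalar `ψ(x y)`.
    have h : ∀ s t : H ⊗[k] H, TensorProduct.map₂ ((LinearMap.mul k H).compr₂ F.ψ)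
        (LinearMap.mul k H) (LinearMap.lTensor H (antipodeSq k H : H →ₗ[k] H) s)
        (LinearMap.lTensor H (antipodeSq k H : H →ₗ[k] H) t) =
        1 ⊗ₜ antipodeSq k H (TensorProduct.lid k H (LinearMap.rTensor H F.ψ (s * t))) := by
      intro s t
      induction s with
      | zero => simp
      | add x y hx hy =>
        simp only [map_add, LinearMap.add_apply, add_mul, TensorProduct.tmul_add, hx, hy]
      | tmul a h =>
        induction t with
        | zero => simp
        | add x y hx hy => simp only [map_add, mul_add, TensorProduct.tmul_add, hx, hy]
        | tmul b l =>
          simp [HopfAlgebra.antipode_mul_antidistrib, TensorProduct.smul_tmul']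
    rw [h, ← Bialgebra.comul_mul, F.right_invariant]
    simp [TensorProduct.smul_tmul']
  exists_pairing_eq_one := by
    obtain ⟨y, hy⟩ := exists_map_eq_one F.ψ_ne_zero
    exact ⟨1, y, by simpa using hy⟩

end InvariantPairing

variable {k : Type u} {H : Type v} [Field k] [Ring H] [HopfAlgebra k H]
variable {A : Type w} [NonUnitalRing A] [Module k A] [IsScalarTower k A A] [SMulCommClass k A A]

/-- The equivariant Morita context with entries `(P i ⊗ A) ⊗ P j`. -/
def rankOneContext (α : Coaction k H A) (P : Fin 2 → InvariantPairing.{u, v, w'} k H) :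
    EquivariantMoritaContext.{u, v, max w w'} k H where
  X i j := ((P i).carrier ⊗[k] A) ⊗[k] (P j).carrier
  mul i j l := rankOneMul A (P i).carrier (P l).carrier (P j).pairing
  mul_assoc _ j l _ := rankOneMul_assoc (P j).pairing (P l).pairing
  comodule i j := ((P i).comodule.tensor α.toRightComodule).tensor (P j).comodule
  coact_mul i j l := coact_rankOneMul (P i).comodule (P j).comodule (P j).comodule (P l).comodule
    α (P j).pairing (P j).invariant

variable {M₁ M₂ : Type*} [AddCommGroup M₁] [Module k M₁] [AddCommGroup M₂] [Module k M₂]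

/-- A balanced map vanishes on the kernel of the multiplication. -/
theorem map_eq_zero_of_lift_rankOneMul_eq_zero {Q : Type*} [AddCommGroup Q] [Module k Q]
    (hA : ∀ s : Finset A, ∃ e : A, ∀ a ∈ s, e * a = a ∧ a * e = a)
    (p : M₂ →ₗ[k] M₂ →ₗ[k] k) {w₀ u₀ : M₂} (h₀ : p w₀ u₀ = 1)
    (π : ((M₁ ⊗[k] A) ⊗[k] M₂) ⊗[k] ((M₂ ⊗[k] A) ⊗[k] M₁) →ₗ[k] Q)
    (hπ : ∀ x y z, π (rankOneMul A M₁ M₂ p x y ⊗ₜ z) = π (x ⊗ₜ rankOneMul A M₂ M₁ p y z))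
    {t : ((M₁ ⊗[k] A) ⊗[k] M₂) ⊗[k] ((M₂ ⊗[k] A) ⊗[k] M₁)}
    (ht : TensorProduct.lift (rankOneMul A M₁ M₁ p) t = 0) : π t = 0 := by
  classical
  -- A candidate section of the multiplication: insert the pair `w₀`, `u₀` with `p w₀ u₀ = 1` in the
  -- middle and `e` as second coefficient.
  let σ (e : A) : (M₁ ⊗[k] A) ⊗[k] M₁ →ₗ[k] ((M₁ ⊗[k] A) ⊗[k] M₂) ⊗[k] ((M₂ ⊗[k] A) ⊗[k] M₁) :=
    TensorProduct.map ((TensorProduct.mk k (M₁ ⊗[k] A) M₂).flip w₀)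
      (TensorProduct.mk k (M₂ ⊗[k] A) M₁ (u₀ ⊗ₜ e))
  have hσ : ∀ e u a w, σ e ((u ⊗ₜ a) ⊗ₜ w) =
      ((u ⊗ₜ a) ⊗ₜ w₀) ⊗ₜ[k] ((u₀ ⊗ₜ e) ⊗ₜ w) := fun _ _ _ _ => rfl
  -- Modulo balancing, `t` is recovered from its product by `σ e`. The unit `e` depends on the
  -- coefficients in `t`, so the claim is made for every unit of a finite set; sums are then handled
  -- by taking unions.
  let Good (t : ((M₁ ⊗[k] A) ⊗[k] M₂) ⊗[k] ((M₂ ⊗[k] A) ⊗[k] M₁)) : Prop :=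
    ∃ s : Finset A, ∀ e : A, (∀ a ∈ s, e * a = a ∧ a * e = a) →
      π t = π (σ e (TensorProduct.lift (rankOneMul A M₁ M₁ p) t))
  have hzero : Good 0 := ⟨∅, fun e _ => by simp⟩
  have hadd : ∀ t t', Good t → Good t' → Good (t + t') := by
    rintro t t' ⟨s, hs⟩ ⟨s', hs'⟩
    refine ⟨s ∪ s', fun e he => ?_⟩
    rw [map_add, map_add, map_add, map_add, hs e fun a ha => he a (Finset.mem_union_left _ ha),
      hs' e fun a ha => he a (Finset.mem_union_right _ ha)]
  have key : ∀ t, Good t := by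
    intro t
    induction t with
    | zero => exact hzero
    | add x y hx hy => exact hadd x y hx hy
    | tmul x y =>
    induction x with
    | zero => simpa only [TensorProduct.zero_tmul] using hzero
    | add x x' hx hx' => simpa only [TensorProduct.add_tmul] using hadd _ _ hx hx'
    | tmul v w =>
    induction v with
    | zero => simpa only [TensorProduct.zero_tmul] using hzero
    | add x x' hx hx' => simpa only [TensorProduct.add_tmul] using hadd _ _ hx hx'
    | tmul u a =>
    induction y with
    | zero => simpa only [TensorProduct.tmul_zero] using hzero
    | add x x' hx hx' => simpa only [TensorProduct.tmul_add] using hadd _ _ hx hx'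
    | tmul v' w' =>
    induction v' with
    | zero => simpa only [TensorProduct.zero_tmul, TensorProduct.tmul_zero] using hzero
    | add x x' hx hx' =>
      simpa only [TensorProduct.add_tmul, TensorProduct.tmul_add] using hadd _ _ hx hx'
    | tmul u' a' =>
    refine ⟨{a, a'}, fun e he => ?_⟩
    have ha := he a (by simp)
    have ha' := he a' (by simp)
    -- Two moves across the tensor sign: `e1` carries `w` to the right, where it contracts with `u'`
    -- to the scalar `p w u'`; `e2` carries the coefficient `a'` to the left, leaving `e` behind.
    have e1 := hπ ((u ⊗ₜ a) ⊗ₜ w₀) ((u₀ ⊗ₜ e) ⊗ₜ w) ((u' ⊗ₜ a') ⊗ₜ w')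
    have e2 := hπ ((u ⊗ₜ a) ⊗ₜ w₀) ((u₀ ⊗ₜ a') ⊗ₜ w₀) ((u₀ ⊗ₜ e) ⊗ₜ w')
    simp only [rankOneMul_tmul, h₀, one_smul, ha.2, ha'.1] at e1
    simp only [rankOneMul_tmul, h₀, one_smul, ha'.2] at e2
    rw [TensorProduct.lift.tmul, rankOneMul_tmul, map_smul, hσ, map_smul, e1, e2,
      TensorProduct.tmul_smul, map_smul]
  obtain ⟨s, hs⟩ := key t
  obtain ⟨e, he⟩ := hA s
  rw [hs e he, ht, map_zero, map_zero]

/-- A pure tensor `(u ⊗ a) ⊗ w` factors through the pair `w₀`, `u₀`, with a local unit of `a` as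
second coefficient. -/
theorem lift_rankOneMul_surjective
    (hA : ∀ s : Finset A, ∃ e : A, ∀ a ∈ s, e * a = a ∧ a * e = a)
    (p : M₂ →ₗ[k] M₂ →ₗ[k] k) {w₀ u₀ : M₂} (h₀ : p w₀ u₀ = 1) :
    Function.Surjective (TensorProduct.lift (rankOneMul A M₁ M₁ p)) := by
  rw [← LinearMap.range_eq_top, eq_top_iff]
  rintro x -
  induction x with
  | zero => exact zero_mem _
  | add x y hx hy => exact add_mem hx hy
  | tmul v w =>
  induction v with
  | zero => rw [TensorProduct.zero_tmul]; exact zero_mem _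
  | add x y hx hy => rw [TensorProduct.add_tmul]; exact add_mem hx hy
  | tmul u a =>
  obtain ⟨e, he⟩ := hA {a}
  exact ⟨((u ⊗ₜ a) ⊗ₜ w₀) ⊗ₜ ((u₀ ⊗ₜ e) ⊗ₜ w), by simp [h₀, (he a (by simp)).2]⟩

/-- The projection to the balanced tensor product is itself a balanced map. That it vanishes on the
kernel of the multiplication is exactly the injectivity of the induced map. -/
theorem rankOneContext_isStrict {α : Coaction k H A} (hα : α.HasCoinvariantLocalUnits)
    (P : Fin 2 → InvariantPairing.{u, v, w'} k H) : (rankOneContext α P).IsStrict := by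
  intro i j
  have hA : ∀ s : Finset A, ∃ e : A, ∀ a ∈ s, e * a = a ∧ a * e = a := fun s =>
    (hα s).imp fun _ h => h.2
  obtain ⟨w₀, u₀, h₀⟩ := (P j).exists_pairing_eq_one
  constructor
  · refine (injective_iff_map_eq_zero _).2 fun q hq => ?_
    obtain ⟨t, rfl⟩ := ((rankOneContext α P).balancing i j).mkQ_surjective q
    exact map_eq_zero_of_lift_rankOneMul_eq_zero hA (P j).pairing h₀
      ((rankOneContext α P).balancing i j).mkQ
      (fun x y z => sub_eq_zero.1 <| (map_sub _ _ _).symm.trans <|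
        (Submodule.Quotient.mk_eq_zero _).2 <| Submodule.subset_span ⟨x, y, z, rfl⟩) hq
  · intro x
    obtain ⟨t, rfl⟩ := lift_rankOneMul_surjective (M₁ := (P i).carrier) hA (P j).pairing h₀ x
    exact ⟨((rankOneContext α P).balancing i j).mkQ t, rfl⟩

end RankOneContext

/-! ### Twisting `V ⊗ M` by a coaction on `V` and a map from `H` to `End M`. -/

section TwistEquiv
variable {k : Type u} {H : Type v} [Field k] [Ring H] [HopfAlgebra k H]
variable {V : Type*} [AddCommGroup V] [Module k V] {M : Type*} [AddCommGroup M] [Module k M]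

namespace RightComodule

/-- The map `v ⊗ m ↦ v₍₀₎ ⊗ ρ(v₍₁₎) m`. -/
def act (δ : RightComodule k H V) (ρ : H →ₗ[k] Module.End k M) :
    V ⊗[k] M →ₗ[k] V ⊗[k] M :=
  LinearMap.lTensor V (TensorProduct.lift ρ) ∘ₗ (TensorProduct.assoc k V H M).toLinearMap ∘ₗ
    LinearMap.rTensor M δ.coact

theorem act_tmul (δ : RightComodule k H V) (ρ : H →ₗ[k] Module.End k M) (v : V) (m : M) :
    δ.act ρ (v ⊗ₜ m) =
      TensorProduct.map LinearMap.id (LinearMap.flip ρ m) (δ.coact v) := by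
  simp only [act, LinearMap.comp_apply, LinearMap.rTensor_tmul, LinearEquiv.coe_coe]
  induction δ.coact v with
  | zero => simp
  | add x y hx hy => simp only [TensorProduct.add_tmul, map_add, hx, hy]
  | tmul v h => simp

/-- By coassociativity the composite is `v ⊗ m ↦ v₍₀₎ ⊗ ρ(v₍₁₎) ρ'(v₍₂₎) m`. Only a convolution
identity is needed; `ρ` need not be a representation, which allows antimultiplicative maps such as
the left leg of `S⁻¹`. -/
theorem act_act (δ : RightComodule k H V) {ρ ρ' : H →ₗ[k] Module.End k M}
    (h : ∀ x : H, LinearMap.mul' k (Module.End k M) (TensorProduct.map ρ ρ' (Coalgebra.comul x)) =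
      (Coalgebra.counit x : k) • 1) (t : V ⊗[k] M) : δ.act ρ (δ.act ρ' t) = t := by
  induction t with
  | zero => simp
  | add x y hx hy => simp only [map_add, hx, hy]
  | tmul v m =>
    rw [act_tmul]
    let Λ : V ⊗[k] H →ₗ[k] V ⊗[k] M :=
      δ.act ρ ∘ₗ TensorProduct.map LinearMap.id (LinearMap.flip ρ' m)
    let T : V ⊗[k] (H ⊗[k] H) →ₗ[k] V ⊗[k] M :=
      LinearMap.lTensor V (LinearMap.applyₗ m ∘ₗ LinearMap.mul' k (Module.End k M) ∘ₗ
        TensorProduct.map ρ ρ')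
    refine δ.transfer_counit T (Λ := Λ) (g := (TensorProduct.mk k V M).flip m) (fun v h => ?_)
      (fun v x => ?_) v
    · simp only [Λ, LinearMap.comp_apply, TensorProduct.map_tmul, LinearMap.id_apply, act_tmul]
      induction δ.coact v with
      | zero => simp
      | add x y hx hy => simp only [TensorProduct.add_tmul, map_add, hx, hy]
      | tmul v l => simp [T]
    · simp only [T, LinearMap.lTensor_tmul, LinearMap.comp_apply, h]
      simp

/-- The map `v ⊗ m ↦ v₍₀₎ ⊗ ρ(v₍₁₎) m` is invertible if `ρ` has a convolution inverse. -/
def actEquiv (δ : RightComodule k H V) (ρ ρ' : H →ₗ[k] Module.End k M)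
    (h : ∀ x : H, LinearMap.mul' k (Module.End k M) (TensorProduct.map ρ ρ' (Coalgebra.comul x)) =
      (Coalgebra.counit x : k) • 1)
    (h' : ∀ x : H, LinearMap.mul' k (Module.End k M) (TensorProduct.map ρ' ρ (Coalgebra.comul x)) =
      (Coalgebra.counit x : k) • 1) : V ⊗[k] M ≃ₗ[k] V ⊗[k] M :=
  LinearEquiv.ofLinearMap (δ.act ρ) (δ.act ρ') (LinearMap.ext (δ.act_act h))
    (LinearMap.ext (δ.act_act h'))

end RightComodule

end TwistEquiv

/-! ### The contraction identity for `ψ`. -/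

section Duality
variable {k : Type u} {H : Type v} [Field k] [Ring H] [HopfAlgebra k H]
variable (F : InvariantFunctionals k H)

/-- `ψ(p₍₁₎ z₍₁₎) ψ(z₍₂₎ S⁻²(p₍₂₎) d) = ψ(p z) ψ(d)` -/
theorem convol_shift_rshift_psi (d p : H) :
    TensorProduct.lift (convol.compl₁₂ (shift F.ψ)
      (rshift.flip F.ψ ∘ₗ LinearMap.mulRight k d ∘ₗ antipodeInvSq F)) (Coalgebra.comul p) =
      F.ψ d • shift F.ψ p := by
  ext z
  let T : H ⊗[k] (H ⊗[k] H) →ₗ[k] k := (TensorProduct.lid k k).toLinearMap ∘ₗ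
    TensorProduct.map (rshift z F.ψ) (rshift d F.ψ ∘ₗ LinearMap.mul' k H ∘ₗ
      TensorProduct.map (antipodeInv F) (antipodeInvSq F))
  refine (regularCoaction k H).toRightComodule.transfer_counit T
    (Λ := LinearMap.applyₗ z ∘ₗ TensorProduct.lift (convol.compl₁₂ (shift F.ψ)
      (rshift.flip F.ψ ∘ₗ LinearMap.mulRight k d ∘ₗ antipodeInvSq F)))
    (g := F.ψ d • rshift z F.ψ) (fun p q => ?_) (fun p q => ?_) p
  -- Strong right invariance, solved for the slice, reads `ψ(p z₍₁₎) z₍₂₎ = ψ(p₍₁₎ z) S⁻¹(p₍₂₎)`.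
  -- The left side becomes `ψ(p₍₁₎ z) ψ(S⁻¹(p₍₂₎) S⁻²(p₍₃₎) d)`, and `S⁻²` is what cancels the
  -- `S⁻¹`.
  · have h1 : sliceLeft (shift F.ψ p) (Coalgebra.comul z) =
        antipodeInv F (sliceLeft (rshift z F.ψ) (Coalgebra.comul p)) := by
      rw [strong_right_invariance, antipodeInv_antipode]
    have h2 : ∀ t : H ⊗[k] H, TensorProduct.lid k k (TensorProduct.map (shift F.ψ p)
        (rshift (antipodeInvSq F q * d) F.ψ) t) =
        F.ψ (sliceLeft (shift F.ψ p) t * (antipodeInvSq F q * d)) := by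
      intro t
      induction t with
      | zero => simp
      | add a b ha hb => simp only [map_add, add_mul, ha, hb]
      | tmul a b => simp
    refine (h2 (Coalgebra.comul z)).trans ?_
    rw [h1]
    change _ = T (TensorProduct.assoc k H H H (Coalgebra.comul p ⊗ₜ q))
    induction Coalgebra.comul (R := k) p with
    | zero => simp
    | add a b ha hb => simp only [map_add, add_mul, TensorProduct.add_tmul, ha, hb]
    | tmul a b => simp [T, mul_assoc]
  · simp only [T, LinearMap.comp_apply, TensorProduct.map_tmul,
      antipodeInv_mul_antipodeInvSq, LinearEquiv.coe_coe]
    simp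
    ring

end Duality

/-! ### Columns: `H ⊗ A` as a model of `A # Ĥ`. -/

section Columns
variable {k : Type u} {H : Type v} [Field k] [Ring H] [HopfAlgebra k H]
variable (F : InvariantFunctionals k H)

/-- `(c ⊗ c') ⊗ (p ⊗ q) ↦ ψ(p - c) * ψ(- c' S⁻²(q) d)` -/
def psiCross (d : H) : H ⊗[k] H →ₗ[k] H ⊗[k] H →ₗ[k] dualHat F :=
  TensorProduct.lift (LinearMap.mk₂ k
    (fun c c' => TensorProduct.lift ((SmashDual.hatCross F (psiEquiv F c)).flip.compl₂
      ((psiEquiv F).toLinearMap ∘ₗ LinearMap.mulLeft k c' ∘ₗ LinearMap.mulRight k d ∘ₗ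
        antipodeInvSq F)))
    (fun _ _ _ => TensorProduct.ext' fun _ _ => by simp)
    (fun _ _ _ => TensorProduct.ext' fun _ _ => by simp)
    (fun _ _ _ => TensorProduct.ext' fun _ _ => by simp [add_mul])
    (fun _ _ _ => TensorProduct.ext' fun _ _ => by simp))

theorem psiCross_tmul (d c c' p q : H) : psiCross F d (c ⊗ₜ c') (p ⊗ₜ q) =
    SmashDual.hatCross F (psiEquiv F c) (psiEquiv F (c' * (antipodeInvSq F q * d))) p := rfl

/-- This is `convol_shift_rshift_psi` translated by `c`. A translation `ω ↦ ω(- c)` distributes over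
a convolution product through the comultiplication of `c`. -/
theorem psiCross_comul (d c p : H) :
    psiCross F d (Coalgebra.comul c) (Coalgebra.comul p) =
      F.ψ d • hatShift F (psiEquiv F c) p := by
  refine Subtype.ext ?_
  have h := congrArg (rshift c) (convol_shift_rshift_psi F d p)
  rw [map_smul] at h
  refine Eq.trans ?_ (h.trans ?_)
  · induction Coalgebra.comul (R := k) p with
    | zero => simp
    | add a b ha hb => simp only [map_add, Submodule.coe_add, ha, hb]
    | tmul p q =>
      rw [TensorProduct.lift.tmul, LinearMap.compl₁₂_apply, rshift_convol]
      induction Coalgebra.comul (R := k) c with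
      | zero => simp
      | add a b ha hb =>
        simp only [map_add, LinearMap.add_apply, Submodule.coe_add, ha, hb]
      | tmul c c' =>
        rw [psiCross_tmul, SmashDual.hatCross_apply, dualHat_coe_mul]
        refine congrArg₂ (fun ω χ => convol ω χ) ?_ ?_
        · exact LinearMap.ext fun x => by simp [hatShift, mul_assoc]
        · exact LinearMap.ext fun x => by simp [mul_assoc]
  · exact LinearMap.ext fun x => by simp [hatShift, mul_assoc]

variable {A : Type w} [NonUnitalRing A] [Module k A] [IsScalarTower k A A] [SMulCommClass k A A]
variable (α : Coaction k H A)

/-- The product `ω a = a₍₀₎ # ω(a₍₁₎ -)` of `ω` in `Ĥ` and `a` in `A`, as an element of `A # Ĥ`. -/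
def dualMul : dualHat F →ₗ[k] A →ₗ[k] A ⊗[k] dualHat F :=
  LinearMap.mk₂ k (fun ω a => LinearMap.lTensor A (hatShift F ω) (α.coact a))
    (fun _ _ _ => by simp [LinearMap.lTensor_add]) (fun _ _ _ => by simp [LinearMap.lTensor_smul])
    (fun _ _ _ => by simp) (fun _ _ _ => by simp)

theorem dualMul_apply (ω : dualHat F) (a : A) :
    dualMul F α ω a = LinearMap.lTensor A (hatShift F ω) (α.coact a) := rfl

/-- `a # ω ↦ a (ω b)`, the multiplication of `A # Ĥ` from the right with elements of `A`. -/
def smashDualMulRight (b : A) : A ⊗[k] dualHat F →ₗ[k] A ⊗[k] dualHat F :=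
  TensorProduct.lift ((LinearMap.rTensorHom (dualHat F) ∘ₗ LinearMap.mul k A).compl₂
    ((dualMul F α).flip b))

theorem smashDualMulRight_tmul (a b : A) (ω : dualHat F) :
    smashDualMulRight F α b (a ⊗ₜ ω) =
      LinearMap.rTensor (dualHat F) (LinearMap.mul k A a) (dualMul F α ω b) := rfl

/-- `(ω a) b = ω (a b)`: `A` acts on `A # Ĥ` from the right by multipliers. This, `mulMap_dualMul`
and `actMap_dualMul` allow computing with elements written as `ω a`. -/
theorem smashDualMulRight_dualMul (ω : dualHat F) (a b : A) :
    smashDualMulRight F α b (dualMul F α ω a) = dualMul F α ω (a * b) := by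
  rw [dualMul_apply, dualMul_apply, α.coact_mul]
  induction α.coact a with
  | zero => simp
  | add x y hx hy => simp only [map_add, add_mul, hx, hy]
  | tmul a p =>
    rw [LinearMap.lTensor_tmul, smashDualMulRight_tmul, dualMul_apply]
    induction α.coact b with
    | zero => simp
    | add x y hx hy => simp only [map_add, mul_add, hx, hy]
    | tmul b q => simp [hatShift_hatShift]

/-- `x (χ b) = (x χ) b`. For `x = a # ω` it reduces, by coassociativity of `α`, to the formula for
translating the convolution product `ω * χ`. -/
theorem mulMap_dualMul (x : A ⊗[k] dualHat F) (χ : dualHat F) (b : A) :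
    SmashDual.mulMap α F x (dualMul F α χ b) = smashDualMulRight F α b
      (LinearMap.lTensor A ((LinearMap.mul k (dualHat F)).flip χ) x) := by
  induction x with
  | zero => simp
  | add x y hx hy => simp only [map_add, LinearMap.add_apply, hx, hy]
  | tmul a ω =>
    rw [LinearMap.lTensor_tmul, smashDualMulRight_tmul, dualMul_apply, dualMul_apply]
    refine α.transfer (TensorProduct.map (LinearMap.mul k A a) (TensorProduct.lift
        ((LinearMap.mul k (dualHat F)).compl₁₂ (hatShift F ω) (hatShift F χ))))
      (Λ := SmashDual.mulMap α F (a ⊗ₜ ω) ∘ₗ LinearMap.lTensor A (hatShift F χ))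
      (Λ' := LinearMap.rTensor (dualHat F) (LinearMap.mul k A a) ∘ₗ
        LinearMap.lTensor A (hatShift F (ω * χ))) (fun b h => ?_) (fun b h => ?_) b
    · rw [LinearMap.comp_apply, LinearMap.lTensor_tmul, SmashDual.mulMap_tmul]
      induction α.coact b with
      | zero => simp
      | add x y hx hy => simp only [map_add, TensorProduct.add_tmul, hx, hy]
      | tmul b p => simp
    · simp [hatShift_mul]

/-- `h · (ω a) = (h · ω) a`, because the translations `ω(p -)` and `ω(- h)` commute. -/
theorem actMap_dualMul (h : H) (ω : dualHat F) (a : A) :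
    SmashDual.actMap F h (dualMul F α ω a) = dualMul F α (hatRshift F h ω) a := by
  rw [dualMul_apply, dualMul_apply]
  induction α.coact a with
  | zero => simp
  | add x y hx hy => simp only [map_add, hx, hy]
  | tmul a p => simp [SmashDual.actMap_tmul, hatRshift_hatShift]

/-- The isomorphism `c ⊗ a ↦ ψ(- c) a` of `H ⊗ A` with `A # Ĥ`. -/
def columnEquiv : H ⊗[k] A ≃ₗ[k] A ⊗[k] dualHat F :=
  TensorProduct.congr (psiEquiv F) (LinearEquiv.refl k A) ≪≫ₗ
    TensorProduct.comm k (dualHat F) A ≪≫ₗ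
    -- Successive translations compose in reversed order, `ω ↦ ω(h -)` being a right action. The
    -- convolution inverse therefore uses `S⁻¹`, through `S⁻¹(x₍₂₎) x₍₁₎ = ε(x) = x₍₂₎ S⁻¹(x₍₁₎)`.
    α.actEquiv (hatShift F).flip ((hatShift F).flip ∘ₗ antipodeInv F)
      (fun x => LinearMap.ext fun ω => by
        have e : ∀ t : H ⊗[k] H, LinearMap.mul' k (Module.End k (dualHat F))
            (TensorProduct.map (hatShift F).flip ((hatShift F).flip ∘ₗ antipodeInv F) t) ω =
            hatShift F ω (LinearMap.mul' k H
              (LinearMap.rTensor H (antipodeInv F) (TensorProduct.comm k H H t))) := by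
          intro t
          induction t with
          | zero => simp
          | add x y hx hy => simp only [map_add, LinearMap.add_apply, hx, hy]
          | tmul p q => simp [hatShift_hatShift]
        rw [e, antipodeInv_mul_comm_comul]
        exact Subtype.ext (LinearMap.ext fun y => by simp [hatShift]))
      (fun x => LinearMap.ext fun ω => by
        have e : ∀ t : H ⊗[k] H, LinearMap.mul' k (Module.End k (dualHat F))
            (TensorProduct.map ((hatShift F).flip ∘ₗ antipodeInv F) (hatShift F).flip t) ω =
            hatShift F ω (LinearMap.mul' k H
              (LinearMap.lTensor H (antipodeInv F) (TensorProduct.comm k H H t))) := by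
          intro t
          induction t with
          | zero => simp
          | add x y hx hy => simp only [map_add, LinearMap.add_apply, hx, hy]
          | tmul p q => simp [hatShift_hatShift]
        rw [e, mul_antipodeInv_comm_comul]
        exact Subtype.ext (LinearMap.ext fun y => by simp [hatShift]))

theorem columnEquiv_tmul (c : H) (a : A) :
    columnEquiv F α (c ⊗ₜ a) = dualMul F α (psiEquiv F c) a :=
  α.act_tmul (hatShift F).flip a (psiEquiv F c)

/-- The comodule `H ⊗ A`, with coaction `c ⊗ a ↦ (c₍₁₎ ⊗ a₍₀₎) ⊗ S²(c₍₂₎) a₍₁₎`. -/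
def columnComodule : RightComodule k H (H ⊗[k] A) :=
  (InvariantPairing.ofPsi F).comodule.tensor α.toRightComodule

variable (A) in
/-- The map `(c ⊗ a) ⊗ h ⊗ (c' ⊗ a') ↦ ψ(h c') c ⊗ a a'`. -/
def columnMul : (H ⊗[k] A) ⊗[k] H →ₗ[k] H ⊗[k] A →ₗ[k] H ⊗[k] A :=
  ((rankOneMul A H k ((LinearMap.mul k H).compr₂ F.ψ)).compr₂
    (TensorProduct.rid k (H ⊗[k] A)).toLinearMap).compl₂ ((TensorProduct.mk k (H ⊗[k] A) k).flip 1)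

theorem columnMul_tmul (c c' h : H) (a a' : A) :
    columnMul F A ((c ⊗ₜ a) ⊗ₜ h) (c' ⊗ₜ a') = F.ψ (h * c') • (c ⊗ₜ (a * a')) := by
  simp [columnMul]

theorem hatRshift_psiEquiv (h c : H) : hatRshift F h (psiEquiv F c) = psiEquiv F (h * c) :=
  Subtype.ext (LinearMap.ext fun x => by simp [hatRshift, mul_assoc])

/-- The multiplication `v₍₀₎ ⊗ v₍₁₎ ↦ v₍₀₎ (S⁻²(v₍₁₎) h · w)` of two columns. -/
theorem mulMap_columnEquiv (v w : H ⊗[k] A) (h : H) :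
    TensorProduct.lift ((SmashDual.mulMap α F ∘ₗ (columnEquiv F α).toLinearMap).compl₂
      ((SmashDual.actMap F).flip (columnEquiv F α w) ∘ₗ LinearMap.mulRight k h ∘ₗ
        antipodeInvSq F)) ((columnComodule F α).coact v) =
      columnEquiv F α (columnMul F A (v ⊗ₜ h) w) := by
  induction w with
  | zero =>
    induction (columnComodule F α).coact v with
    | zero => simp
    | add x y hx hy => simp only [map_add, hx, hy]; simp
    | tmul v p => simp
  | add x y hx hy =>
    simp only [map_add, ← hx, ← hy]
    induction (columnComodule F α).coact v with
    | zero => simp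
    | add x y hx hy => simp only [map_add, hx, hy]; abel
    | tmul v p => simp
  | tmul c' a' =>
    induction v with
    | zero => simp
    | add x y hx hy => simp only [map_add, TensorProduct.add_tmul, LinearMap.add_apply, hx, hy]
    | tmul c a =>
      -- For `v = c ⊗ a` the coaction leg is `S²(c₍₂₎) a₍₁₎`, so `h` is preceded by `c₍₂₎
      -- S⁻²(a₍₁₎)`. Before the final multiplication by `a'` the product is `a₍₀₎ # ψ(a₍₁₎ - c₍₁₎) *
      -- ψ(- c₍₂₎ S⁻²(a₍₂₎) h c')`, and `psiCross_comul` with `d = h c'` contracts it to `ψ(h c')`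
      -- times `ψ(- c) a`.
      rw [columnMul_tmul, map_smul, columnEquiv_tmul, columnEquiv_tmul,
        ← smashDualMulRight_dualMul]
      set Λ := TensorProduct.lift ((SmashDual.mulMap α F ∘ₗ (columnEquiv F α).toLinearMap).compl₂
        ((SmashDual.actMap F).flip (dualMul F α (psiEquiv F c') a') ∘ₗ LinearMap.mulRight k h ∘ₗ
          antipodeInvSq F)) with hΛ
      have h₁ : ∀ (t : H ⊗[k] H) (a : A) (q : H),
          Λ (TensorProduct.map₂ (TensorProduct.mk k H A) (LinearMap.mul k H)
            (LinearMap.lTensor H (antipodeSq k H : H →ₗ[k] H) t) (a ⊗ₜ q)) =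
          smashDualMulRight F α a' (LinearMap.lTensor A (psiCross F (h * c') t)
            (TensorProduct.assoc k A H H (α.coact a ⊗ₜ q))) := by
        intro t a q
        induction t with
        | zero => simp
        | add x y hx hy =>
          simp only [map_add, LinearMap.add_apply, LinearMap.lTensor_add, hx, hy]
        | tmul p p' =>
          have e : Λ ((p ⊗ₜ a) ⊗ₜ (antipodeSq k H p' * q)) =
              SmashDual.mulMap α F (dualMul F α (psiEquiv F p) a)
                (dualMul F α (psiEquiv F (p' * (antipodeInvSq F q * (h * c')))) a') := by
            simp [hΛ, columnEquiv_tmul, actMap_dualMul, hatRshift_psiEquiv, antipodeInvSq_apply,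
              antipodeInv_mul, mul_assoc]
          refine e.trans ?_
          rw [mulMap_dualMul, dualMul_apply]
          congr 1
          induction α.coact a with
          | zero => simp
          | add x y hx hy => simp only [map_add, TensorProduct.add_tmul, hx, hy]
          | tmul a l => simp [psiCross_tmul]
      exact α.transfer (smashDualMulRight F α a' ∘ₗ
          LinearMap.lTensor A (psiCross F (h * c') (Coalgebra.comul c)))
        (Λ := Λ ∘ₗ TensorProduct.map₂ (TensorProduct.mk k H A) (LinearMap.mul k H)
            (LinearMap.lTensor H (antipodeSq k H : H →ₗ[k] H) (Coalgebra.comul c)))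
        (Λ' := F.ψ (h * c') • smashDualMulRight F α a' ∘ₗ
          LinearMap.lTensor A (hatShift F (psiEquiv F c))) (h₁ _)
        (fun a p => by simp [psiCross_comul]) a

/-- A column is a rank-one matrix whose last leg is the trivial comodule `k`, so the statement is
`coact_rankOneMul` seen through `(H ⊗ A) ⊗ k ≅ H ⊗ A`. -/
theorem coact_columnMul (x : (H ⊗[k] A) ⊗[k] H) (w : H ⊗[k] A) :
    (columnComodule F α).coact (columnMul F A x w) =
      TensorProduct.map₂ (columnMul F A) (LinearMap.mul k H)
        (((columnComodule F α).tensor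
          ((regularCoaction k H).twist (antipodeSq k H)).toRightComodule).coact x)
        ((columnComodule F α).coact w) := by
  let δ : RightComodule k H H := ((regularCoaction k H).twist (antipodeSq k H)).toRightComodule
  have h := congrArg (LinearMap.rTensor H (TensorProduct.rid k (H ⊗[k] A)).toLinearMap)
    (coact_rankOneMul δ δ δ (RightComodule.trivial k H k) α ((LinearMap.mul k H).compr₂ F.ψ)
      (InvariantPairing.ofPsi F).invariant x (w ⊗ₜ 1))
  have e₁ : ∀ z, (columnComodule F α).coact (TensorProduct.rid k (H ⊗[k] A) z) =
      LinearMap.rTensor H (TensorProduct.rid k (H ⊗[k] A)).toLinearMap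
        (((columnComodule F α).tensor (RightComodule.trivial k H k)).coact z) := by
    intro z
    induction z with
    | zero => simp
    | add x y hx hy => simp only [map_add, hx, hy]
    | tmul v c =>
      rw [TensorProduct.rid_tmul, map_smul, RightComodule.tensor_coact_tmul]
      induction (columnComodule F α).coact v with
      | zero => simp
      | add x y hx hy => simp only [map_add, LinearMap.add_apply, smul_add, hx, hy]
      | tmul v h => simp [RightComodule.trivial, TensorProduct.smul_tmul']
  refine (e₁ _).trans (h.trans ?_)
  rw [RightComodule.tensor_coact_tmul]
  change LinearMap.rTensor H _ (TensorProduct.map₂ _ _ (((columnComodule F α).tensor δ).coact x)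
    (TensorProduct.map₂ _ _ ((columnComodule F α).coact w) _)) = _
  induction ((columnComodule F α).tensor δ).coact x with
  | zero => simp
  | add x y hx hy => simp only [map_add, LinearMap.add_apply, hx, hy]
  | tmul v h =>
    induction (columnComodule F α).coact w with
    | zero => simp
    | add x y hx hy => simp only [map_add, LinearMap.add_apply, hx, hy]
    | tmul v' l => simp [RightComodule.trivial, columnMul]

end Columns

/-! ### From `V ⊗ H` to a smash product `B # H`, for a comodule `V` isomorphic to `B`. -/

section SmashColumns
variable {k : Type u} {H : Type v} [Field k] [Ring H] [HopfAlgebra k H]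
variable (F : InvariantFunctionals k H)
variable {V : Type w} [AddCommGroup V] [Module k V] (δ : RightComodule k H V)

section
variable {M : Type w'} [AddCommGroup M] [Module k M] (J : V ≃ₗ[k] M)

/-- The isomorphism `v ⊗ h ↦ J(v₍₀₎) # S⁻²(v₍₁₎) h`. -/
def smashEquiv : V ⊗[k] H ≃ₗ[k] M ⊗[k] H :=
  -- `S⁻²` is multiplicative and comultiplicative, so its convolution inverse is `S ∘ S⁻² = S⁻¹`.
  δ.actEquiv (LinearMap.mul k H ∘ₗ antipodeInvSq F) (LinearMap.mul k H ∘ₗ antipodeInv F)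
    (fun x => by
      have e : ∀ t : H ⊗[k] H, LinearMap.mul' k (Module.End k H) (TensorProduct.map
          (LinearMap.mul k H ∘ₗ antipodeInvSq F) (LinearMap.mul k H ∘ₗ antipodeInv F) t) =
          LinearMap.mul k H (LinearMap.mul' k H
            (TensorProduct.map (antipodeInvSq F) (antipodeInv F) t)) := by
        intro t
        induction t with
        | zero => simp
        | add x y hx hy => simp only [map_add, hx, hy]
        | tmul p q => exact LinearMap.ext fun y => by simp [mul_assoc]
      rw [e, antipodeInvSq_mul_antipodeInv]
      exact LinearMap.ext fun y => by simp)
    (fun x => by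
      have e : ∀ t : H ⊗[k] H, LinearMap.mul' k (Module.End k H) (TensorProduct.map
          (LinearMap.mul k H ∘ₗ antipodeInv F) (LinearMap.mul k H ∘ₗ antipodeInvSq F) t) =
          LinearMap.mul k H (LinearMap.mul' k H
            (TensorProduct.map (antipodeInv F) (antipodeInvSq F) t)) := by
        intro t
        induction t with
        | zero => simp
        | add x y hx hy => simp only [map_add, hx, hy]
        | tmul p q => exact LinearMap.ext fun y => by simp [mul_assoc]
      rw [e, antipodeInv_mul_antipodeInvSq]
      exact LinearMap.ext fun y => by simp) ≪≫ₗ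
  TensorProduct.congr J (LinearEquiv.refl k H)

theorem smashEquiv_tmul (v : V) (h : H) : smashEquiv F δ J (v ⊗ₜ h) =
    TensorProduct.map J.toLinearMap (LinearMap.mulRight k h ∘ₗ antipodeInvSq F) (δ.coact v) := by
  have e : smashEquiv F δ J (v ⊗ₜ h) = TensorProduct.congr J (LinearEquiv.refl k H)
      (δ.act (LinearMap.mul k H ∘ₗ antipodeInvSq F) (v ⊗ₜ h)) := rfl
  rw [e, RightComodule.act_tmul]
  induction δ.coact v with
  | zero => simp
  | add x y hx hy => simp only [map_add, hx, hy]
  | tmul v p => simp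

end

theorem antipodeInvSq_antipodeSq (x : H) : antipodeInvSq F (antipodeSq k H x) = x := by
  simp [antipodeInvSq_apply]

theorem antipodeSq_antipodeInvSq (x : H) : antipodeSq k H (antipodeInvSq F x) = x := by
  simp [antipodeInvSq_apply]

/-- `smashEquiv` is a comodule morphism for the `S²`-twisted dual coaction. -/
theorem coactMap_smashEquiv {B : Type w'} [NonUnitalRing B] [Module k B] (J : V ≃ₗ[k] B)
    (x : V ⊗[k] H) :
    LinearMap.lTensor (B ⊗[k] H) (antipodeSq k H : H →ₗ[k] H)
      (Smash.coactMap k H B (smashEquiv F δ J x)) =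
    LinearMap.rTensor H (smashEquiv F δ J).toLinearMap
      ((δ.tensor ((regularCoaction k H).twist (antipodeSq k H)).toRightComodule).coact x) := by
  induction x with
  | zero => simp
  | add x y hx hy => simp only [map_add, hx, hy]
  | tmul v l =>
    rw [smashEquiv_tmul]
    -- Both sides are `(J(v₍₀₎) # S⁻²(v₍₁₎) l₍₁₎) ⊗ v₍₂₎ S²(l₍₂₎)`: the twist of the dual coaction
    -- turns its leg `S⁻²(v₍₂₎) l₍₂₎` into `v₍₂₎ S²(l₍₂₎)`. The argument `t` stands for `Δ(l)`.
    let T (t : H ⊗[k] H) : V ⊗[k] (H ⊗[k] H) →ₗ[k] (B ⊗[k] H) ⊗[k] H :=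
      LinearMap.lTensor (B ⊗[k] H) (antipodeSq k H : H →ₗ[k] H) ∘ₗ
        (TensorProduct.assoc k B H H).symm.toLinearMap ∘ₗ TensorProduct.map J.toLinearMap
          (LinearMap.mulRight k t ∘ₗ TensorProduct.map (antipodeInvSq F) (antipodeInvSq F))
    have hT : ∀ t v r, T t (v ⊗ₜ r) = LinearMap.lTensor (B ⊗[k] H) (antipodeSq k H : H →ₗ[k] H)
        ((TensorProduct.assoc k B H H).symm (J v ⊗ₜ
          (TensorProduct.map (antipodeInvSq F) (antipodeInvSq F) r * t))) := fun _ _ _ => rfl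
    have h₁ : ∀ (t : H ⊗[k] H) (v : V) (p : H),
        LinearMap.rTensor H (smashEquiv F δ J).toLinearMap
          (TensorProduct.map₂ (TensorProduct.mk k V H) (LinearMap.mul k H) (v ⊗ₜ p)
            (LinearMap.lTensor H (antipodeSq k H : H →ₗ[k] H) t)) =
        T t (TensorProduct.assoc k V H H (δ.coact v ⊗ₜ p)) := by
      intro t v p
      induction t with
      | zero =>
        have h0 : T 0 = 0 := TensorProduct.ext' fun _ _ => by simp [hT]
        simp [h0]
      | add x y hx hy =>
        have h0 : T (x + y) = T x + T y := TensorProduct.ext' fun _ _ => by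
          simp [hT, mul_add, TensorProduct.tmul_add]
        simp only [map_add, LinearMap.add_apply, hx, hy, h0]
      | tmul r r' =>
        have e : smashEquiv F δ J (v ⊗ₜ r) ⊗ₜ[k] (p * antipodeSq k H r') =
            T (r ⊗ₜ r') (TensorProduct.assoc k V H H (δ.coact v ⊗ₜ p)) := by
          rw [smashEquiv_tmul]
          induction δ.coact v with
          | zero => simp
          | add x y hx hy => simp only [map_add, TensorProduct.add_tmul, hx, hy]
          | tmul v s =>
            rw [TensorProduct.assoc_tmul, hT, TensorProduct.map_tmul, TensorProduct.map_tmul,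
              Algebra.TensorProduct.tmul_mul_tmul, TensorProduct.assoc_symm_tmul,
              LinearMap.lTensor_tmul]
            refine congrArg _ ?_
            refine Eq.trans ?_ (map_mul (antipodeSq k H) _ _).symm
            rw [antipodeSq_antipodeInvSq]
        exact e
    refine (δ.transfer (T (Coalgebra.comul l)) (Λ := LinearMap.rTensor H
        (smashEquiv F δ J).toLinearMap ∘ₗ
        ((TensorProduct.map₂ (TensorProduct.mk k V H) (LinearMap.mul k H)).flip
          (LinearMap.lTensor H (antipodeSq k H : H →ₗ[k] H) (Coalgebra.comul l))))
      (Λ' := LinearMap.lTensor (B ⊗[k] H) (antipodeSq k H : H →ₗ[k] H) ∘ₗ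
        Smash.coactMap k H B ∘ₗ
          TensorProduct.map J.toLinearMap (LinearMap.mulRight k l ∘ₗ antipodeInvSq F))
      (h₁ _) (fun v p => ?_) v).symm
    rw [hT, ← comul_antipodeInvSq, ← Bialgebra.comul_mul]
    rfl

variable {B : Type w'} [NonUnitalRing B] [Module k B] [IsScalarTower k B B] [SMulCommClass k B B]
variable (ρ : HopfAction k H B) (J : V ≃ₗ[k] B)

/-- `smashEquiv` is multiplicative if `C` is a comodule morphism that describes the products
`J(v₍₀₎) (S⁻²(v₍₁₎) h · J(w))`. -/
theorem mulMap_smashEquiv (C : V ⊗[k] H →ₗ[k] V →ₗ[k] V)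
    (hC : ∀ v w h, TensorProduct.lift ((LinearMap.mul k B ∘ₗ J.toLinearMap).compl₂
      (ρ.act.flip (J w) ∘ₗ LinearMap.mulRight k h ∘ₗ antipodeInvSq F)) (δ.coact v) =
        J (C (v ⊗ₜ h) w))
    (hδ : ∀ x w, δ.coact (C x w) = TensorProduct.map₂ C (LinearMap.mul k H)
      ((δ.tensor ((regularCoaction k H).twist (antipodeSq k H)).toRightComodule).coact x)
      (δ.coact w)) (x : V ⊗[k] H) (w : V) (h : H) :
    Smash.mulMap ρ (smashEquiv F δ J x) (smashEquiv F δ J (w ⊗ₜ h)) =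
      smashEquiv F δ J (C x w ⊗ₜ h) := by
  induction x with
  | zero => simp
  | add x y hx hy => simp only [map_add, LinearMap.add_apply, TensorProduct.add_tmul, hx, hy]
  | tmul v l =>
    rw [smashEquiv_tmul, smashEquiv_tmul, smashEquiv_tmul, hδ]
    induction δ.coact w with
    | zero => simp
    | add x y hx hy => simp only [map_add, hx, hy]
    | tmul w q =>
      -- The common value is `J(v₍₀₎) (S⁻²(v₍₁₎) l₍₁₎ · J(w)) # S⁻²(v₍₂₎) l₍₂₎ S⁻²(q) h`, with `w ⊗
      -- q` a term of the coaction. Here `hC` rewrites the left leg as `J(C(v₍₀₎ ⊗ l₍₁₎) w)`, and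
      -- the right leg is `S⁻²(v₍₁₎ S²(l₍₂₎) q) h`, as `hδ` requires.
      let T (t : H ⊗[k] H) : V ⊗[k] (H ⊗[k] H) →ₗ[k] B ⊗[k] H := TensorProduct.lift
        (((TensorProduct.mapBilinear (RingHom.id k) H H B H).flip
          (LinearMap.mulRight k (antipodeInvSq F q * h)) ∘ₗ
            (Smash.cross ρ).flip (J w) ∘ₗ J.toLinearMap).compl₂
          (LinearMap.mulRight k t ∘ₗ TensorProduct.map (antipodeInvSq F) (antipodeInvSq F)))
      have hT : ∀ t v r, T t (v ⊗ₜ r) = TensorProduct.map (Smash.cross ρ (J v) (J w))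
          (LinearMap.mulRight k (antipodeInvSq F q * h))
          (TensorProduct.map (antipodeInvSq F) (antipodeInvSq F) r * t) := fun _ _ _ => rfl
      let Φ : V ⊗[k] H →ₗ[k] B ⊗[k] H :=
        TensorProduct.map J.toLinearMap (LinearMap.mulRight k h ∘ₗ antipodeInvSq F)
      have h₁ : ∀ (t : H ⊗[k] H) (v : V) (p : H),
          Φ (TensorProduct.map₂ C (LinearMap.mul k H)
            (TensorProduct.map₂ (TensorProduct.mk k V H) (LinearMap.mul k H) (v ⊗ₜ p)
              (LinearMap.lTensor H (antipodeSq k H : H →ₗ[k] H) t)) (w ⊗ₜ q)) =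
          T t (TensorProduct.assoc k V H H (δ.coact v ⊗ₜ p)) := by
        intro t v p
        induction t with
        | zero =>
          have h0 : T 0 = 0 := TensorProduct.ext' fun _ _ => by simp [hT]
          simp [h0]
        | add x y hx hy =>
          have h0 : T (x + y) = T x + T y := TensorProduct.ext' fun _ _ => by simp [hT, mul_add]
          simp only [map_add, LinearMap.add_apply, hx, hy, h0]
        | tmul r r' =>
          have e : Φ (C (v ⊗ₜ r) w ⊗ₜ (p * antipodeSq k H r' * q)) =
              J (C (v ⊗ₜ r) w) ⊗ₜ (antipodeInvSq F p * r' * (antipodeInvSq F q * h)) := by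
            simp only [Φ, TensorProduct.map_tmul, LinearMap.comp_apply, LinearMap.mulRight_apply,
              antipodeInvSq_mul, antipodeInvSq_antipodeSq, mul_assoc, LinearEquiv.coe_coe]
          refine e.trans ?_
          rw [← hC]
          induction δ.coact v with
          | zero => simp
          | add x y hx hy => simp only [map_add, TensorProduct.add_tmul, hx, hy]
          | tmul v s => simp [hT, mul_assoc]
      refine (δ.transfer (T (Coalgebra.comul l)) (Λ := Φ ∘ₗ
        ((TensorProduct.map₂ C (LinearMap.mul k H)).flip (w ⊗ₜ q)) ∘ₗ
          ((TensorProduct.map₂ (TensorProduct.mk k V H) (LinearMap.mul k H)).flip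
            (LinearMap.lTensor H (antipodeSq k H : H →ₗ[k] H) (Coalgebra.comul l))))
        (Λ' := (Smash.mulMap ρ).flip (Φ (w ⊗ₜ q)) ∘ₗ
          TensorProduct.map J.toLinearMap (LinearMap.mulRight k l ∘ₗ antipodeInvSq F))
        (h₁ _) (fun v p => ?_) v).symm
      rw [hT, ← comul_antipodeInvSq, ← Bialgebra.comul_mul]
      rfl

end SmashColumns

/-! ### The double smash product as an algebra of rank-one matrices. -/

section Final
variable {k : Type u} {H : Type v} [Field k] [Ring H] [HopfAlgebra k H]
variable {A : Type w} [NonUnitalRing A] [Module k A] [IsScalarTower k A A] [SMulCommClass k A A]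
variable (α : Coaction k H A) (F : InvariantFunctionals k H)

/-- The isomorphism of `(H ⊗ A) ⊗ H` with `(A # Ĥ) # H`. -/
def doubleSmashEquiv : (H ⊗[k] A) ⊗[k] H ≃ₗ[k] DoubleSmash α F :=
  smashEquiv F (columnComodule F α) (columnEquiv F α)

/-- The last leg of the right factor takes no part in a rank-one product, which is thus `columnMul`
with a spectator; `mulMap_smashEquiv` applies with `C = columnMul`. -/
theorem doubleSmashEquiv_rankOneMul (x y : (H ⊗[k] A) ⊗[k] H) :
    doubleSmashEquiv α F (rankOneMul A H H ((LinearMap.mul k H).compr₂ F.ψ) x y) =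
      doubleSmashEquiv α F x * doubleSmashEquiv α F y := by
  induction y with
  | zero => rw [map_zero, map_zero, mul_zero]
  | add y z hy hz => rw [map_add, map_add, map_add, mul_add, hy, hz]
  | tmul w h =>
    have e : rankOneMul A H H ((LinearMap.mul k H).compr₂ F.ψ) x (w ⊗ₜ h) =
        columnMul F A x w ⊗ₜ h := by
      induction w with
      | zero => simp
      | add w z hw hz => simp only [TensorProduct.add_tmul, map_add, hw, hz]
      | tmul c' a' =>
        induction x with
        | zero => simp
        | add x y hx hy => simp only [TensorProduct.add_tmul, map_add, LinearMap.add_apply, hx, hy]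
        | tmul v l =>
          induction v with
          | zero => simp
          | add x y hx hy =>
            simp only [TensorProduct.add_tmul, map_add, LinearMap.add_apply, hx, hy]
          | tmul c a => simp [columnMul_tmul, TensorProduct.smul_tmul']
    rw [e]
    exact (mulMap_smashEquiv F (columnComodule F α) (SmashDual.action α F) (columnEquiv F α)
      (columnMul F A) (mulMap_columnEquiv F α) (coact_columnMul F α) x w h).symm

theorem coact_doubleSmashEquiv (x : (H ⊗[k] A) ⊗[k] H) :
    (twistedBidualCoaction α F).coact (doubleSmashEquiv α F x) =
      LinearMap.rTensor H (doubleSmashEquiv α F).toLinearMap (((columnComodule F α).tensor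
        ((regularCoaction k H).twist (antipodeSq k H)).toRightComodule).coact x) :=
  coactMap_smashEquiv (B := SmashDual α F) F (columnComodule F α) (columnEquiv F α) x

end Final

/-! ### Transport of rank-one matrices, and the corner isomorphic to `A`. -/

section CornerIsos
variable {k : Type u} {H : Type v} [Field k] [Ring H] [HopfAlgebra k H]
variable {A : Type w} [NonUnitalRing A] [Module k A] [IsScalarTower k A A] [SMulCommClass k A A]
variable {M N : Type*} [AddCommGroup M] [Module k M] [AddCommGroup N] [Module k N]

variable (A) in
/-- The map on `(M ⊗ A) ⊗ M` induced by an isomorphism of `M`. -/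
def rankOneEquiv (e : M ≃ₗ[k] N) : (M ⊗[k] A) ⊗[k] M ≃ₗ[k] (N ⊗[k] A) ⊗[k] N :=
  TensorProduct.congr (TensorProduct.congr e (LinearEquiv.refl k A)) e

theorem rankOneEquiv_rankOneMul (e : M ≃ₗ[k] N) (p : M →ₗ[k] M →ₗ[k] k)
    (x y : (M ⊗[k] A) ⊗[k] M) :
    rankOneEquiv A e (rankOneMul A M M p x y) =
      rankOneMul A N N (p.compl₁₂ e.symm.toLinearMap e.symm.toLinearMap)
        (rankOneEquiv A e x) (rankOneEquiv A e y) := by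
  have h : (rankOneMul A M M p).compr₂ (rankOneEquiv A e).toLinearMap =
      (rankOneMul A N N (p.compl₁₂ e.symm.toLinearMap e.symm.toLinearMap)).compl₁₂
        (rankOneEquiv A e).toLinearMap (rankOneEquiv A e).toLinearMap := by
    ext
    simp [rankOneEquiv]
  exact LinearMap.congr_fun₂ h x y

theorem coact_rankOneEquiv (e : M ≃ₗ[k] N) (δ : RightComodule k H M) (α : Coaction k H A)
    (x : (M ⊗[k] A) ⊗[k] M) :
    (((δ.congr e).tensor α.toRightComodule).tensor (δ.congr e)).coact (rankOneEquiv A e x) =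
      LinearMap.rTensor H (rankOneEquiv A e).toLinearMap
        (((δ.tensor α.toRightComodule).tensor δ).coact x) :=
  RightComodule.tensor_coact_congr
    (RightComodule.tensor_coact_congr (δ.congr_coact e) fun a => by simp)
    (δ.congr_coact e) x

variable (k A) in
/-- The isomorphism `a ↦ (1 ⊗ a) ⊗ 1`. -/
def unitEquiv : A ≃ₗ[k] (k ⊗[k] A) ⊗[k] k :=
  (TensorProduct.lid k A).symm ≪≫ₗ (TensorProduct.rid k (k ⊗[k] A)).symm

theorem unitEquiv_mul (a b : A) : unitEquiv k A (a * b) =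
    rankOneMul A k k (LinearMap.mul k k) (unitEquiv k A a) (unitEquiv k A b) := by
  simp [unitEquiv]

theorem coact_unitEquiv (α : Coaction k H A) (a : A) :
    (((RightComodule.trivial k H k).tensor α.toRightComodule).tensor (.trivial k H k)).coact
        (unitEquiv k A a) =
      LinearMap.rTensor H (unitEquiv k A).toLinearMap (α.coact a) := by
  change RightComodule.coact _ ((1 ⊗ₜ a) ⊗ₜ 1) = _
  rw [RightComodule.tensor_coact_tmul, RightComodule.tensor_coact_tmul]
  induction α.coact a with
  | zero => simp
  | add x y hx hy => simp only [map_add, LinearMap.add_apply, hx, hy]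
  | tmul a h => simp [RightComodule.trivial, unitEquiv]

end CornerIsos

/-! ### The equivariant Morita equivalence. -/

section EquivariantMorita
variable {k : Type u} {H : Type v} [Field k] [Ring H] [HopfAlgebra k H]
variable {A : Type w} [NonUnitalRing A] [Module k A] [IsScalarTower k A A] [SMulCommClass k A A]

/-- An algebra isomorphic to `(M ⊗ A) ⊗ M`, for an invariant pairing on `M` isomorphic to `Q i`, is
the corresponding diagonal entry of `rankOneContext α Q`. -/
theorem nonempty_cornerIso {B : Type*} [NonUnitalRing B] [Module k B] [IsScalarTower k B B]
    [SMulCommClass k B B] {α : Coaction k H A} {β : Coaction k H B}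
    {Q : Fin 2 → InvariantPairing.{u, v, w'} k H} {i : Fin 2} {M : Type*} [AddCommGroup M]
    [Module k M] (δ : RightComodule k H M) (p : M →ₗ[k] M →ₗ[k] k)
    (e : M ≃ₗ[k] (Q i).carrier) (hδ : (Q i).comodule = δ.congr e)
    (hp : (Q i).pairing = p.compl₁₂ e.symm.toLinearMap e.symm.toLinearMap)
    (θ : B ≃ₗ[k] (M ⊗[k] A) ⊗[k] M) (hmul : ∀ a b, θ (a * b) = rankOneMul A M M p (θ a) (θ b))
    (hcoact : ∀ b, ((δ.tensor α.toRightComodule).tensor δ).coact (θ b) =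
      LinearMap.rTensor H θ.toLinearMap (β.coact b)) :
    Nonempty (CornerIso β (rankOneContext α Q) i) := by
  refine ⟨⟨θ ≪≫ₗ rankOneEquiv A e, fun a b => ?_, fun b => ?_⟩⟩
  · change rankOneEquiv A e (θ (a * b)) = rankOneMul A (Q i).carrier (Q i).carrier (Q i).pairing
      (rankOneEquiv A e (θ a)) (rankOneEquiv A e (θ b))
    rw [hp, hmul, rankOneEquiv_rankOneMul]
  · change (((Q i).comodule.tensor α.toRightComodule).tensor (Q i).comodule).coact
      (rankOneEquiv A e (θ b)) = LinearMap.rTensor H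
        ((rankOneEquiv A e).toLinearMap ∘ₗ θ.toLinearMap) (β.coact b)
    rw [hδ, coact_rankOneEquiv, hcoact, LinearMap.rTensor_comp_apply]

/-- A comodule algebra is equivariantly Morita equivalent to its twisted double smash product. -/
theorem equivariantlyMoritaEquivalent_twistedBidualCoaction (F : InvariantFunctionals k H)
    (α : Coaction k H A) (hα : α.HasCoinvariantLocalUnits) :
    EquivariantlyMoritaEquivalent α (twistedBidualCoaction α F) := by
  -- The carriers `k` and `H` live in different universes; `ULift` puts both into one so that they
  -- form a single family.
  let Q : Fin 2 → InvariantPairing.{u, v, max u v} k H :=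
    ![(InvariantPairing.unit k H).congr ULift.moduleEquiv.{u, u, v}.symm,
      (InvariantPairing.ofPsi F).congr ULift.moduleEquiv.{u, v, u}.symm]
  refine ⟨rankOneContext.{u, v, w, max u v} α Q, rankOneContext_isStrict hα Q,
    nonempty_cornerIso (.trivial k H k) (LinearMap.mul k k) ULift.moduleEquiv.{u, u, v}.symm
      rfl rfl (unitEquiv k A) unitEquiv_mul (coact_unitEquiv α),
    nonempty_cornerIso ((regularCoaction k H).twist (antipodeSq k H)).toRightComodule
      ((LinearMap.mul k H).compr₂ F.ψ) ULift.moduleEquiv.{u, v, u}.symm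
      rfl rfl (doubleSmashEquiv α F).symm (fun a b => ?_) (fun b => ?_)⟩
  · rw [LinearEquiv.symm_apply_eq, doubleSmashEquiv_rankOneMul, LinearEquiv.apply_symm_apply,
      LinearEquiv.apply_symm_apply]
  · obtain ⟨x, rfl⟩ := (doubleSmashEquiv α F).surjective b
    rw [coact_doubleSmashEquiv, LinearEquiv.symm_apply_apply, ← LinearMap.rTensor_comp_apply]
    have e : (doubleSmashEquiv α F).symm.toLinearMap ∘ₗ (doubleSmashEquiv α F).toLinearMap =
      LinearMap.id := LinearMap.ext (doubleSmashEquiv α F).symm_apply_apply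
    rw [e, LinearMap.rTensor_id]
    rfl

end EquivariantMorita

end EquivMorita

end

theorem mainTheorem6 {k H A : Type*} [Field k] [Ring H] [HopfAlgebra k H]
    [NonUnitalRing A] [Module k A] [IsScalarTower k A A] [SMulCommClass k A A]
    (F : EquivMorita.InvariantFunctionals k H) (α : EquivMorita.Coaction k H A)
    (hα : α.HasCoinvariantLocalUnits) :
    EquivMorita.EquivariantlyMoritaEquivalent α (EquivMorita.twistedBidualCoaction α F) :=
  EquivMorita.equivariantlyMoritaEquivalent_twistedBidualCoaction F α hα
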